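/- Let $(X_0,X_1)$ be an interpolation couple of complex Banach spaces, that is, both are continuously embedded in a Banach space which is their sum $\Sigma=X_0+X_1$. For $0<s<1$ let $X_s$ be the complex interpolation space: the space of all values $f(s)$, with the quotient norm, where $f$ ranges over the Calder\'on space of bounded continuous functions $f:\{0\le \operatorname{Re}z\le 1\}\to\Sigma$, holomorphic in the interior, for which $y\mapsto f(iy)\in X_0$ and $y\mapsto f(1+iy)\in X_1$ are bounded and continuous, normed by $\max\{\sup_y\|f(iy)\|_{X_0},\sup_y\|f(1+iy)\|_{X_1}\}$. A common (unconditional, resp. Schauder) basis of the couple is a sequence $(e_n)$ in $X_0\cap X_1$ which is an (unconditional, resp. Schauder) basis of $X_0$ and of $X_1$, the coordinates of every element of $X_0\cap X_1$ being the same in $X_0$ and in $X_1$; supports and blocks in $X_\theta$ refer to $(e_n)$. For a space $W$ with unconditional basis $(u_i)$ let $\pi^M_W(n)=\sup\|x_1+\cdots+x_n\|$ over all families of $n$ vectors of norm at most $1$ in $W$ that are finitely and disjointly supported with respect to $(u_i)$. For a closed subspace $W$ of a space with Schauder basis $(e_i)$ let $\pi^A_W(n)=\sup\|x_1+\cdots+x_n\|$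 over all finitely supported $x_1,\dots,x_n\in W$ of norm at most $1$ with $n<x_1<\cdots<x_n$ (successive supports with respect to $(e_i)$, contained in $\{n+1,n+2,\dots\}$). For a Banach space $E$ let $p_E=\sup\{p\in[1,2]: E\text{ has Rademacher type }p\}$. We write $a_n\sim b_n$ if each sequence is eventually bounded by a constant multiple of the other. Two Banach spaces are totally incomparable if no closed infinite-dimensional subspace of one is isomorphic to a closed subspace of the other. Let $0<\theta<1$. (1) Suppose that the couple has a common unconditional basis, that $\limsup_n \pi^M_{X_1}(n)/\pi^M_{X_0}(n)=\infty$, and that $\pi^M_W(n)\sim\pi^M_{X_0}(n)^{1-\theta}\pi^M_{X_1}(n)^{\theta}$ for every closed subspace $W$ of $X_\theta$ spanned by a sequence of nonzero disjointly supported vectors (which is the basis of $W$ used in $\pi^M_W$; the constants in $\sim$ may depend on $W$). Then $X_\theta$ and $X_t$ are totally incomparable for all $0<t<\theta$. (2) Suppose that the couple has a common Schauder basis, that $\limsup_n \pi^A_{X_1}(n)/\pi^A_{X_0}(n)=\infty$, and that $\pi^A_W(n)\sim\pi^A_{X_0}(n)^{1-\theta}\pi^A_{X_1}(n)^{\theta}$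 for every block subspace $W$ of $X_\theta$ (the closed span of an infinite sequence of nonzero finitely supported vectors with successive supports; again the constants may depend on $W$). Then $X_\theta$ and $X_t$ are totally incomparable for all $0<t<\theta$. (3) Suppose that $X_0$ has type $p_{X_0}$, that $X_1$ has type $p_{X_1}$, that $p_{X_0}<p_{X_1}$, and that $\frac1{p_W}=\frac{1-\theta}{p_{X_0}}+\frac{\theta}{p_{X_1}}$ for every closed infinite-dimensional subspace $W$ of $X_\theta$. Then $X_\theta$ and $X_t$ are totally incomparable for all $\theta<t<1$. -/

import Mathlib

open Filter Topology Asymptotics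
open scoped BoundedContinuousFunction

noncomputable section

/-! ### Interpolation couples and the complex interpolation method -/

/-- An interpolation couple `(X₀, X₁)` of Banach spaces: both are continuously embedded in a Banach
space `S`, which is their sum.  (By the open mapping theorem the norm of `S` is then equivalent to
the usual norm `inf {‖x₀‖ + ‖x₁‖ : x = x₀ + x₁}` of `X₀ + X₁`.) -/
structure InterpolationCouple (X₀ X₁ S : Type*)
    [NormedAddCommGroup X₀] [NormedSpace ℂ X₀] [CompleteSpace X₀]
    [NormedAddCommGroup X₁] [NormedSpace ℂ X₁] [CompleteSpace X₁]
    [NormedAddCommGroup S] [NormedSpace ℂ S] [CompleteSpace S] where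
  /-- The inclusion of `X₀` in the sum. -/
  i₀ : X₀ →L[ℂ] S
  /-- The inclusion of `X₁` in the sum. -/
  i₁ : X₁ →L[ℂ] S
  inj₀ : Function.Injective i₀
  inj₁ : Function.Injective i₁
  sum_eq : ∀ s : S, ∃ (x₀ : X₀) (x₁ : X₁), i₀ x₀ + i₁ x₁ = s

namespace InterpolationCouple

variable {X₀ X₁ S : Type*}
  [NormedAddCommGroup X₀] [NormedSpace ℂ X₀] [CompleteSpace X₀]
  [NormedAddCommGroup X₁] [NormedSpace ℂ X₁] [CompleteSpace X₁]
  [NormedAddCommGroup S] [NormedSpace ℂ S] [CompleteSpace S]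
  (C : InterpolationCouple X₀ X₁ S)

/-- `f` belongs to the Calderón space and `g = (g₀, g₁)` is its pair of boundary functions: `f` is
continuous and bounded on the closed strip `0 ≤ Re z ≤ 1` with values in the sum, holomorphic on the
open strip, and `y ↦ f (iy)`, `y ↦ f (1 + iy)` are the bounded continuous functions `g₀ : ℝ → X₀` and
`g₁ : ℝ → X₁`. -/
structure IsCalderon (f : ℂ → S) (g : (ℝ →ᵇ X₀) × (ℝ →ᵇ X₁)) : Prop where
  continuousOn : ContinuousOn f (Complex.re ⁻¹' Set.Icc 0 1)
  bounded : ∃ M : ℝ, ∀ z : ℂ, z.re ∈ Set.Icc (0 : ℝ) 1 → ‖f z‖ ≤ M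
  differentiableOn : DifferentiableOn ℂ f (Complex.re ⁻¹' Set.Ioo 0 1)
  left : ∀ y : ℝ, f (y * Complex.I) = C.i₀ (g.1 y)
  right : ∀ y : ℝ, f (1 + y * Complex.I) = C.i₁ (g.2 y)

variable {C} in
/-- Maximum principle: a Calderón function is controlled by its boundary functions. -/
theorem IsCalderon.norm_le {f : ℂ → S} {g : (ℝ →ᵇ X₀) × (ℝ →ᵇ X₁)} (h : C.IsCalderon f g)
    {z : ℂ} (hz : z.re ∈ Set.Icc (0 : ℝ) 1) : ‖f z‖ ≤ (‖C.i₀‖ + ‖C.i₁‖) * ‖g‖ := by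
  obtain ⟨M, hM⟩ := h.bounded
  have hcl : closure (Complex.re ⁻¹' Set.Ioo (0 : ℝ) 1) = Complex.re ⁻¹' Set.Icc (0 : ℝ) 1 := by
    rw [Complex.closure_preimage_re, closure_Ioo (by norm_num)]
  have h0 : ∀ y : ℝ, ‖g.1 y‖ ≤ ‖g‖ := fun y => (g.1.norm_coe_le_norm y).trans (norm_fst_le g)
  have h1 : ∀ y : ℝ, ‖g.2 y‖ ≤ ‖g‖ := fun y => (g.2.norm_coe_le_norm y).trans (norm_snd_le g)
  have n0 := norm_nonneg C.i₀
  have n1 := norm_nonneg C.i₁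
  have ng := norm_nonneg g
  refine PhragmenLindelof.vertical_strip (a := 0) (b := 1) ⟨h.differentiableOn, ?_⟩ ?_ ?_ ?_
    hz.1 hz.2
  · rw [hcl]; exact h.continuousOn
  · refine ⟨0, by simp [Real.pi_pos], 0, ?_⟩
    refine IsBigO.of_bound M ?_
    refine (eventually_inf_principal.2 (Eventually.of_forall fun w hw => ?_))
    simpa using hM w ⟨hw.1.le, hw.2.le⟩
  · intro w hw
    have : w = (w.im : ℂ) * Complex.I := by apply Complex.ext <;> simp [hw]
    rw [this, h.left]
    calc _ ≤ ‖C.i₀‖ * ‖g.1 w.im‖ := C.i₀.le_opNorm _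
      _ ≤ ‖C.i₀‖ * ‖g‖ := by gcongr; exact h0 _
      _ ≤ _ := by nlinarith
  · intro w hw
    have : w = 1 + (w.im : ℂ) * Complex.I := by apply Complex.ext <;> simp [hw]
    rw [this, h.right]
    calc _ ≤ ‖C.i₁‖ * ‖g.2 w.im‖ := C.i₁.le_opNorm _
      _ ≤ ‖C.i₁‖ * ‖g‖ := by gcongr; exact h1 _
      _ ≤ _ := by nlinarith

variable {C} in
theorem IsCalderon.add {f f' : ℂ → S} {g g' : (ℝ →ᵇ X₀) × (ℝ →ᵇ X₁)}
    (h : C.IsCalderon f g) (h' : C.IsCalderon f' g') : C.IsCalderon (f + f') (g + g') where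
  continuousOn := h.continuousOn.add h'.continuousOn
  bounded := by
    obtain ⟨M, hM⟩ := h.bounded
    obtain ⟨M', hM'⟩ := h'.bounded
    exact ⟨M + M', fun z hz => norm_add_le_of_le (hM z hz) (hM' z hz)⟩
  differentiableOn := h.differentiableOn.add h'.differentiableOn
  left y := by simp [h.left, h'.left]
  right y := by simp [h.right, h'.right]

variable {C} in
theorem IsCalderon.smul {f : ℂ → S} {g : (ℝ →ᵇ X₀) × (ℝ →ᵇ X₁)} (c : ℂ)
    (h : C.IsCalderon f g) : C.IsCalderon (c • f) (c • g) where
  continuousOn := h.continuousOn.const_smul c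
  bounded := by
    obtain ⟨M, hM⟩ := h.bounded
    refine ⟨‖c‖ * M, fun z hz => ?_⟩
    rw [Pi.smul_apply, norm_smul]
    gcongr
    exact hM z hz
  differentiableOn := h.differentiableOn.const_smul c
  left y := by simp [h.left]
  right y := by simp [h.right]

theorem isCalderon_const {x₀ : X₀} {x₁ : X₁} (h : C.i₀ x₀ = C.i₁ x₁) :
    C.IsCalderon (fun _ => C.i₀ x₀)
      (BoundedContinuousFunction.const ℝ x₀, BoundedContinuousFunction.const ℝ x₁) where
  continuousOn := continuousOn_const
  bounded := ⟨_, fun _ _ => le_rfl⟩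
  differentiableOn := differentiableOn_const _
  left y := by simp
  right y := by simpa using h

/-- The Calderón space of the couple.  A function of the Calderón space is determined by its pair of
boundary functions, and is represented by it; the norm
`max (sup ‖f (iy)‖_{X₀}) (sup ‖f (1 + iy)‖_{X₁})` is the one inherited from the product. -/
def calderonSpace : Submodule ℂ ((ℝ →ᵇ X₀) × (ℝ →ᵇ X₁)) where
  carrier := {g | ∃ f : ℂ → S, C.IsCalderon f g}
  add_mem' := by
    rintro g g' ⟨f, hf⟩ ⟨f', hf'⟩
    exact ⟨_, hf.add hf'⟩
  zero_mem' := ⟨0, by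
    have h := C.isCalderon_const (x₀ := 0) (x₁ := 0) (by simp)
    rw [map_zero] at h
    exact h⟩
  smul_mem' := by
    rintro c g ⟨f, hf⟩
    exact ⟨_, hf.smul c⟩

/-- The Calderón function (on the closed strip) with the given boundary functions. -/
def extend (g : C.calderonSpace) : ℂ → S := g.2.choose

theorem isCalderon_extend (g : C.calderonSpace) : C.IsCalderon (C.extend g) g.1 := g.2.choose_spec

variable {C} in
theorem IsCalderon.eq_extend {f : ℂ → S} {g : C.calderonSpace} (h : C.IsCalderon f g.1) {z : ℂ}
    (hz : z.re ∈ Set.Icc (0 : ℝ) 1) : C.extend g z = f z := by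
  have := ((C.isCalderon_extend g).add (h.smul (-1))).norm_le hz
  have h0 : (g : (ℝ →ᵇ X₀) × (ℝ →ᵇ X₁)) + (-1 : ℂ) • (g : (ℝ →ᵇ X₀) × (ℝ →ᵇ X₁)) = 0 := by
    simp
  rw [h0, norm_zero, mul_zero] at this
  have := norm_le_zero_iff.1 this
  simp only [Pi.add_apply, neg_smul, one_smul] at this
  exact add_neg_eq_zero.1 this

/-- Evaluation `δ_θ : f ↦ f(θ)` on the Calderón space, for `0 < θ < 1`. -/
def eval (θ : Set.Ioo (0 : ℝ) 1) : C.calderonSpace →L[ℂ] S :=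
  have hθ : ((θ : ℝ) : ℂ).re ∈ Set.Icc (0 : ℝ) 1 := ⟨θ.2.1.le, θ.2.2.le⟩
  LinearMap.mkContinuous
    { toFun := fun g => C.extend g ((θ : ℝ) : ℂ)
      map_add' := fun g g' => IsCalderon.eq_extend (g := g + g')
        ((C.isCalderon_extend g).add (C.isCalderon_extend g')) hθ
      map_smul' := fun c g => IsCalderon.eq_extend (g := c • g)
        ((C.isCalderon_extend g).smul c) hθ }
    (‖C.i₀‖ + ‖C.i₁‖)
    (fun g => (C.isCalderon_extend g).norm_le hθ)

/-- The complex interpolation space `X_θ`: the range of `δ_θ` with its quotient norm, realised as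
the quotient of the Calderón space by the closed subspace `ker δ_θ`. -/
def interpSpace (θ : Set.Ioo (0 : ℝ) 1) : Type _ := C.calderonSpace ⧸ (C.eval θ).ker

instance (θ : Set.Ioo (0 : ℝ) 1) : NormedAddCommGroup (C.interpSpace θ) :=
  haveI : IsClosed (((C.eval θ).ker : Submodule ℂ C.calderonSpace) : Set C.calderonSpace) :=
    (C.eval θ).isClosed_ker
  Submodule.Quotient.normedAddCommGroup (C.eval θ).ker

instance (θ : Set.Ioo (0 : ℝ) 1) : NormedSpace ℂ (C.interpSpace θ) :=
  Submodule.Quotient.normedSpace (C.eval θ).ker ℂ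

/-- The element of `X_θ` given by a vector of `X₀ ∩ X₁`, which is described by its two incarnations
`x₀ ∈ X₀` and `x₁ ∈ X₁`: the class of the constant function. -/
def ofInter (θ : Set.Ioo (0 : ℝ) 1) (x₀ : X₀) (x₁ : X₁) (h : C.i₀ x₀ = C.i₁ x₁) :
    C.interpSpace θ :=
  Submodule.Quotient.mk
    (⟨(BoundedContinuousFunction.const ℝ x₀, BoundedContinuousFunction.const ℝ x₁),
      _, C.isCalderon_const h⟩ : C.calderonSpace)

/-- Two bases (Schauder or unconditional, according to `L`) of `X₀` and of `X₁` are a common basis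
of the couple: the basis vectors coincide, and so do the coordinates of each element of
`X₀ ∩ X₁`. -/
structure IsCommonBasis {L : SummationFilter ℕ} (e₀ : GeneralSchauderBasis ℕ ℂ X₀ L)
    (e₁ : GeneralSchauderBasis ℕ ℂ X₁ L) : Prop where
  basis_eq : ∀ n, C.i₀ (e₀ n) = C.i₁ (e₁ n)
  coord_eq : ∀ (x₀ : X₀) (x₁ : X₁), C.i₀ x₀ = C.i₁ x₁ → ∀ n, e₀.coord n x₀ = e₁.coord n x₁

variable {C} in
/-- The common basis, as a sequence in `X_θ`. -/
def IsCommonBasis.vec {L : SummationFilter ℕ} {e₀ : GeneralSchauderBasis ℕ ℂ X₀ L}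
    {e₁ : GeneralSchauderBasis ℕ ℂ X₁ L} (h : C.IsCommonBasis e₀ e₁) (θ : Set.Ioo (0 : ℝ) 1)
    (n : ℕ) : C.interpSpace θ :=
  C.ofInter θ (e₀ n) (e₁ n) (h.basis_eq n)

end InterpolationCouple

/-! ### Supports, blocks, and the parameters `π^M`, `π^A` -/

section Parameters

variable {E : Type*} [NormedAddCommGroup E] [NormedSpace ℂ E]

/-- `w` is a sequence of nonzero, disjointly supported vectors with respect to the basis `e`.
(The vectors supported in `A`, i.e. whose coordinates off `A` vanish, form the closed linear span of
the `e n`, `n ∈ A`.) -/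
def DisjointlySupported (e w : ℕ → E) : Prop :=
  ∃ A : ℕ → Set ℕ, (∀ i j, i ≠ j → Disjoint (A i) (A j)) ∧
    ∀ i, w i ≠ 0 ∧ w i ∈ (Submodule.span ℂ (e '' A i)).topologicalClosure

/-- `A < B` for finite sets of integers: every element of `A` is less than every element of `B`. -/
def SetLT (A B : Finset ℕ) : Prop := ∀ k ∈ A, ∀ l ∈ B, k < l

/-- `w` is a block sequence of the basis `e`: nonzero finitely supported vectors with successive
supports. -/
def IsBlockSequence (e w : ℕ → E) : Prop :=
  ∃ A : ℕ → Finset ℕ, (∀ i j, i < j → SetLT (A i) (A j)) ∧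
    ∀ i, w i ≠ 0 ∧ w i ∈ Submodule.span ℂ (e '' (A i : Set ℕ))

/-- The closed linear span of a sequence. -/
def closedSpan (w : ℕ → E) : Submodule ℂ E :=
  (Submodule.span ℂ (Set.range w)).topologicalClosure

/-- `π^M(n)` of the closed span of `u`, a space with unconditional basis `u`: the supremum of
`‖x₁ + ⋯ + xₙ‖` over the families of `n` vectors of norm at most `1` that are finitely and disjointly
supported with respect to `u`. -/
def piM (u : ℕ → E) (n : ℕ) : ℝ :=
  sSup {r : ℝ | ∃ (A : Fin n → Finset ℕ) (x : Fin n → E),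
    (∀ i j, i ≠ j → Disjoint (A i) (A j)) ∧
    (∀ j, x j ∈ Submodule.span ℂ (u '' (A j : Set ℕ))) ∧
    (∀ j, ‖x j‖ ≤ 1) ∧ r = ‖∑ j, x j‖}

/-- `π^A_W(n)` for a subspace `W` of a space with Schauder basis `e`: the supremum of
`‖x₁ + ⋯ + xₙ‖` over `x₁, …, xₙ ∈ W` of norm at most `1`, finitely supported with
`n < x₁ < ⋯ < xₙ`.  The basis is numbered from `0` here, so that `n < x`, i.e. that the first `n`
coordinates of `x` vanish, means that the support of `x` is in `{n, n + 1, …}`. -/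
def piA (e : ℕ → E) (W : Submodule ℂ E) (n : ℕ) : ℝ :=
  sSup {r : ℝ | ∃ (A : Fin n → Finset ℕ) (x : Fin n → E),
    (∀ j, ∀ k ∈ A j, n ≤ k) ∧
    (∀ i j, i < j → SetLT (A i) (A j)) ∧
    (∀ j, x j ∈ W ∧ x j ∈ Submodule.span ℂ (e '' (A j : Set ℕ))) ∧
    (∀ j, ‖x j‖ ≤ 1) ∧ r = ‖∑ j, x j‖}

/-! ### Rademacher type and total incomparability -/

/-- `E` has (Rademacher) type `p`: the average of `‖± x₁ ± ⋯ ± xₙ‖` over all choices of signs is at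
most `K (‖x₁‖ ^ p + ⋯ + ‖xₙ‖ ^ p) ^ (1 / p)`, with `K` independent of `n` and the vectors. -/
def HasType (E : Type*) [NormedAddCommGroup E] (p : ℝ) : Prop :=
  ∃ K : ℝ, ∀ (n : ℕ) (x : Fin n → E),
    (∑ ε : Fin n → ℤˣ, ‖∑ j, ε j • x j‖) / 2 ^ n ≤ K * (∑ j, ‖x j‖ ^ p) ^ (1 / p)

/-- `p_E = sup {p : E has type p}`, where `p` ranges over `[1, 2]` as usual for type (a nonzero
space has no type greater than `2`). -/
def typeIndex (E : Type*) [NormedAddCommGroup E] : ℝ :=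
  sSup {p : ℝ | p ∈ Set.Icc 1 2 ∧ HasType E p}

end Parameters

/-- Two normed spaces are totally incomparable: no closed infinite-dimensional subspace of the one is
isomorphic to a closed subspace of the other. -/
def TotallyIncomparable (E F : Type*) [NormedAddCommGroup E] [NormedSpace ℂ E]
    [NormedAddCommGroup F] [NormedSpace ℂ F] : Prop :=
  ¬ ∃ (Y : Submodule ℂ E) (Z : Submodule ℂ F),
    IsClosed (Y : Set E) ∧ IsClosed (Z : Set F) ∧ ¬ FiniteDimensional ℂ Y ∧ Nonempty (Y ≃L[ℂ] Z)

end

/-!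
Suppose that an infinite-dimensional subspace `Y` of `X_θ` embeds in `X_t`. In each of the three
parts an isomorphic invariant of subspaces is pinned down by the hypothesis on `X_θ`, while in `X_t`
it is bounded by interpolation between `X₀` and `X₁`; since `t ≠ θ`, the two are not compatible.

*Bases.* The common basis is a Schauder basis of `X_θ` and of `X_t`
(`InterpolationCouple.IsCommonBasis.interpBasis`): after multiplication by `exp (z ^ 2 - θ ^ 2)` the
boundary functions of a Calderón function vanish at infinity, so that the partial sums converge
uniformly on the boundary. A gliding hump in both spaces at once
(`SchauderBasis.exists_equivalent_blocks`) gives equivalent block sequences `u` in `X_θ` and `v` in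
`X_t` supported in the same intervals. Hence the parameter `π` of the span of `u` is at most a
constant times that of `X_t`. The latter is `O(π₀ ^ (1 - t) * π₁ ^ t)`, by the three lines theorem
applied to the sum of the basis projections of the Calderón functions of the given vectors
(`piM_vec_le`, `piA_vec_le`). As `π₁ / π₀` is unbounded and `t < θ`, this contradicts the
hypothesis that the parameter of the span of `u` is of order `π₀ ^ (1 - θ) * π₁ ^ θ`.

*Type.* If `X₀` has type `p₀` and `X₁` has type `p₁`, then `X_t` has type `p_t`, where
`1 / p_t = (1 - t) / p₀ + t / p₁` (`InterpolationCouple.hasType_interpSpace`), so that the type index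
of `Y` is at least `p_t`, which exceeds `p_θ` when `t > θ`. The type inequalities bound *averages* over
signs of the boundary norms at each boundary point, not the average of the suprema. The passage from
one to the other is `IsCalderon.sum_norm_interp_le`: a Calderón function `f` is replaced by
`f(z) * H(t) / H(z)`, where `H` is analytic, its real part majorizes the norm of `f` on the boundary,
and `H(t)` is real and bounded by a Poisson average of these norms. The sums of Poisson kernels of
half-planes suffice for `H` (`exists_herglotz_majorant`).
-/

noncomputable section

namespace InterpolationCouple

variable {X₀ X₁ S : Type*}
  [NormedAddCommGroup X₀] [NormedSpace ℂ X₀] [CompleteSpace X₀]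
  [NormedAddCommGroup X₁] [NormedSpace ℂ X₁] [CompleteSpace X₁]
  [NormedAddCommGroup S] [NormedSpace ℂ S] [CompleteSpace S]
  (C : InterpolationCouple X₀ X₁ S)

/-! ### The interpolation space as a subspace of the sum -/

/-- The inclusion `X_θ → X₀ + X₁`, sending the class of `f` to `f(θ)`. -/
def incl (θ : Set.Ioo (0 : ℝ) 1) : C.interpSpace θ →L[ℂ] S :=
  LinearMap.mkContinuous
    ((C.eval θ).ker.liftQ (C.eval θ : C.calderonSpace →ₗ[ℂ] S) le_rfl : C.interpSpace θ →ₗ[ℂ] S)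
    ‖C.eval θ‖ (by
      intro x
      refine le_of_forall_pos_le_add fun ε hε => ?_
      -- the `+ 1` covers the case that `δ_θ` vanishes
      have hδ : 0 < ε / (‖C.eval θ‖ + 1) := by positivity
      obtain ⟨g, rfl, hg⟩ := Submodule.Quotient.norm_mk_lt (S := (C.eval θ).ker) x hδ
      change ‖C.eval θ g‖ ≤ _
      refine ((C.eval θ).le_opNorm g).trans ?_
      have h1 : ‖C.eval θ‖ * (ε / (‖C.eval θ‖ + 1)) ≤ ε := by
        rw [mul_div_assoc', div_le_iff₀ (by positivity)]
        nlinarith [norm_nonneg (C.eval θ)]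
      have := mul_le_mul_of_nonneg_left hg.le (norm_nonneg (C.eval θ))
      rw [mul_add] at this
      exact this.trans (add_le_add le_rfl h1))

theorem incl_injective (θ : Set.Ioo (0 : ℝ) 1) : Function.Injective (C.incl θ) := by
  intro x y hxy
  obtain ⟨g, rfl⟩ := Submodule.Quotient.mk_surjective _ x
  obtain ⟨g', rfl⟩ := Submodule.Quotient.mk_surjective _ y
  refine (Submodule.Quotient.eq _).2 ?_
  change C.eval θ g = C.eval θ g' at hxy
  rw [LinearMap.mem_ker]
  change C.eval θ (g - g') = 0
  rw [map_sub, hxy, sub_self]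

variable {C}

theorem re_mem_Icc (θ : Set.Ioo (0 : ℝ) 1) : ((θ : ℝ) : ℂ).re ∈ Set.Icc (0 : ℝ) 1 :=
  ⟨θ.2.1.le, θ.2.2.le⟩

theorem exists_isCalderon {θ : Set.Ioo (0 : ℝ) 1} (x : C.interpSpace θ) {ε : ℝ} (hε : 0 < ε) :
    ∃ (f : ℂ → S) (g : (ℝ →ᵇ X₀) × (ℝ →ᵇ X₁)), C.IsCalderon f g ∧ f (θ : ℝ) = C.incl θ x ∧
      (∀ y, ‖g.1 y‖ ≤ ‖x‖ + ε) ∧ ∀ y, ‖g.2 y‖ ≤ ‖x‖ + ε := by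
  obtain ⟨g, rfl, hg⟩ := Submodule.Quotient.norm_mk_lt (S := (C.eval θ).ker) x hε
  exact ⟨C.extend g, g.1, C.isCalderon_extend g, rfl,
    fun y => ((g.1.1.norm_coe_le_norm y).trans (norm_fst_le g.1)).trans hg.le,
    fun y => ((g.1.2.norm_coe_le_norm y).trans (norm_snd_le g.1)).trans hg.le⟩

/-- The norm of `X_θ` is bounded by the boundary norms of any Calderón function which represents the
vector: Calderón functions with the same value at `θ` differ by an element of `ker δ_θ`. -/
theorem IsCalderon.norm_interp_le {f : ℂ → S} {g : (ℝ →ᵇ X₀) × (ℝ →ᵇ X₁)} (h : C.IsCalderon f g)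
    {θ : Set.Ioo (0 : ℝ) 1} {x : C.interpSpace θ} (hx : C.incl θ x = f (θ : ℝ)) {M : ℝ}
    (h₀ : ∀ y, ‖g.1 y‖ ≤ M) (h₁ : ∀ y, ‖g.2 y‖ ≤ M) : ‖x‖ ≤ M := by
  have hM : 0 ≤ M := (norm_nonneg _).trans (h₀ 0)
  have : x = Submodule.Quotient.mk (⟨g, f, h⟩ : C.calderonSpace) := by
    apply C.incl_injective θ
    rw [hx]
    exact (IsCalderon.eq_extend (g := ⟨g, f, h⟩) h (re_mem_Icc θ)).symm
  rw [this]
  refine (Submodule.Quotient.norm_mk_le (S := (C.eval θ).ker) _).trans ?_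
  change ‖g‖ ≤ M
  exact max_le ((BoundedContinuousFunction.norm_le hM).2 h₀)
    ((BoundedContinuousFunction.norm_le hM).2 h₁)

theorem IsCalderon.zero : C.IsCalderon 0 0 := by
  have h := C.isCalderon_const (x₀ := 0) (x₁ := 0) (by simp)
  rw [map_zero] at h
  exact h

theorem IsCalderon.sum {ι : Type*} (s : Finset ι) {f : ι → ℂ → S}
    {g : ι → (ℝ →ᵇ X₀) × (ℝ →ᵇ X₁)} (h : ∀ i ∈ s, C.IsCalderon (f i) (g i)) :
    C.IsCalderon (∑ i ∈ s, f i) (∑ i ∈ s, g i) := by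
  classical
  induction s using Finset.induction_on with
  | empty => simpa using IsCalderon.zero
  | insert a s ha ih =>
    rw [Finset.sum_insert ha, Finset.sum_insert ha]
    exact (h a (by simp)).add (ih fun i hi => h i (by simp [hi]))

/-- The Calderón space is a module over the bounded continuous functions on the closed strip which
are holomorphic in its interior. -/
theorem IsCalderon.exists_mul {f : ℂ → S} {g : (ℝ →ᵇ X₀) × (ℝ →ᵇ X₁)} (h : C.IsCalderon f g)
    {φ : ℂ → ℂ} (hc : ContinuousOn φ (Complex.re ⁻¹' Set.Icc 0 1))
    (hd : DifferentiableOn ℂ φ (Complex.re ⁻¹' Set.Ioo 0 1))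
    (hb : ∃ B : ℝ, ∀ z : ℂ, z.re ∈ Set.Icc (0 : ℝ) 1 → ‖φ z‖ ≤ B) :
    ∃ g' : (ℝ →ᵇ X₀) × (ℝ →ᵇ X₁), C.IsCalderon (fun z => φ z • f z) g' ∧
      (∀ y : ℝ, g'.1 y = φ (y * Complex.I) • g.1 y) ∧
      ∀ y : ℝ, g'.2 y = φ (1 + y * Complex.I) • g.2 y := by
  obtain ⟨B, hB⟩ := hb
  have c₀ : Continuous fun y : ℝ => φ (y * Complex.I) :=
    hc.comp_continuous (by fun_prop) (fun y => by simp)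
  have c₁ : Continuous fun y : ℝ => φ (1 + y * Complex.I) :=
    hc.comp_continuous (by fun_prop) (fun y => by simp)
  have hB0 : 0 ≤ B := (norm_nonneg _).trans (hB 0 (by simp))
  refine ⟨(BoundedContinuousFunction.ofNormedAddCommGroup
      (fun y : ℝ => φ (y * Complex.I) • g.1 y) (c₀.smul g.1.continuous) (B * ‖g.1‖) fun y => ?_,
    BoundedContinuousFunction.ofNormedAddCommGroup
      (fun y : ℝ => φ (1 + y * Complex.I) • g.2 y) (c₁.smul g.2.continuous) (B * ‖g.2‖)
      fun y => ?_), ⟨?_, ?_, ?_, ?_, ?_⟩, fun y => rfl, fun y => rfl⟩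
  · rw [norm_smul]
    exact mul_le_mul (hB _ (by simp)) (g.1.norm_coe_le_norm y) (norm_nonneg _) hB0
  · rw [norm_smul]
    exact mul_le_mul (hB _ (by simp)) (g.2.norm_coe_le_norm y) (norm_nonneg _) hB0
  · exact hc.smul h.continuousOn
  · obtain ⟨M, hM⟩ := h.bounded
    refine ⟨B * M, fun z hz => ?_⟩
    rw [norm_smul]
    exact mul_le_mul (hB z hz) (hM z hz) (norm_nonneg _) hB0
  · exact hd.smul h.differentiableOn
  · intro y; simp [h.left]
  · intro y; simp [h.right]

/-- Operators on `X₀`, `X₁` which are restrictions of one operator on the sum act on the Calderón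
space. -/
theorem IsCalderon.map {f : ℂ → S} {g : (ℝ →ᵇ X₀) × (ℝ →ᵇ X₁)} (h : C.IsCalderon f g)
    {T₀ : X₀ →L[ℂ] X₀} {T₁ : X₁ →L[ℂ] X₁} {T : S →L[ℂ] S}
    (h₀ : ∀ x, T (C.i₀ x) = C.i₀ (T₀ x)) (h₁ : ∀ x, T (C.i₁ x) = C.i₁ (T₁ x)) :
    C.IsCalderon (fun z => T (f z)) (T₀.compLeftContinuousBounded ℝ g.1,
      T₁.compLeftContinuousBounded ℝ g.2) where
  continuousOn := T.continuous.comp_continuousOn h.continuousOn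
  bounded := by
    obtain ⟨M, hM⟩ := h.bounded
    exact ⟨‖T‖ * M, fun z hz => (T.le_opNorm _).trans
      (mul_le_mul_of_nonneg_left (hM z hz) (norm_nonneg _))⟩
  differentiableOn := T.differentiable.comp_differentiableOn h.differentiableOn
  left y := by simp [h.left, h₀]
  right y := by simp [h.right, h₁]

/-- Multiplication by `r ^ (z - θ)` keeps the value at `θ` and multiplies the norms on the two
boundary lines by `r ^ (-θ)` and `r ^ (1 - θ)`. -/
theorem IsCalderon.exists_rescale {f : ℂ → S} {g : (ℝ →ᵇ X₀) × (ℝ →ᵇ X₁)} (h : C.IsCalderon f g)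
    (θ : Set.Ioo (0 : ℝ) 1) {r : ℝ} (hr : 0 < r) :
    ∃ (f' : ℂ → S) (g' : (ℝ →ᵇ X₀) × (ℝ →ᵇ X₁)), C.IsCalderon f' g' ∧
      f' (θ : ℝ) = f (θ : ℝ) ∧ (∀ y, ‖g'.1 y‖ = r ^ (-(θ : ℝ)) * ‖g.1 y‖) ∧
      ∀ y, ‖g'.2 y‖ = r ^ (1 - (θ : ℝ)) * ‖g.2 y‖ := by
  set φ : ℂ → ℂ := fun z => Complex.exp ((Real.log r : ℂ) * (z - (θ : ℝ))) with hφ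
  have hn : ∀ z : ℂ, ‖φ z‖ = Real.exp (Real.log r * (z.re - θ)) := fun z => by
    simp [hφ, Complex.norm_exp]
  have hd : Differentiable ℂ φ := by fun_prop
  obtain ⟨g', hg', e₀, e₁⟩ := h.exists_mul (φ := φ) hd.continuous.continuousOn
    hd.differentiableOn ⟨Real.exp |Real.log r|, fun z hz => by
      rw [hn, Real.exp_le_exp]
      refine (le_abs_self _).trans ?_
      rw [abs_mul]
      refine mul_le_of_le_one_right (abs_nonneg _) (abs_le.2 ⟨?_, ?_⟩) <;>
        linarith [hz.1, hz.2, θ.2.1, θ.2.2]⟩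
  refine ⟨_, g', hg', by simp [hφ], fun y => ?_, fun y => ?_⟩
  · rw [e₀, norm_smul, hn, Real.rpow_def_of_pos hr]; simp
  · rw [e₁, norm_smul, hn, Real.rpow_def_of_pos hr]; simp

/-- The choice `r = a / b` in the factors `r ^ (-θ)` and `r ^ (1 - θ)` makes the two bounds equal. -/
theorem rpow_balance {a b θ : ℝ} (ha : 0 < a) (hb : 0 < b) :
    (a / b) ^ (-θ) * a = a ^ (1 - θ) * b ^ θ ∧ (a / b) ^ (1 - θ) * b = a ^ (1 - θ) * b ^ θ := by
  have e : ∀ s : ℝ, (a / b) ^ s = a ^ s * b ^ (-s) := fun s => by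
    rw [Real.div_rpow ha.le hb.le, Real.rpow_neg hb.le, div_eq_mul_inv]
  have ea : a ^ (1 - θ) = a ^ (-θ) * a := by
    rw [show 1 - θ = -θ + 1 by ring, Real.rpow_add_one ha.ne']
  have eb : b ^ θ = b ^ (-(1 - θ)) * b := by
    rw [← Real.rpow_add_one hb.ne']; ring_nf
  constructor
  · rw [e, ea, neg_neg]; ring
  · rw [e, eb]; ring

/-- The three lines theorem for the interpolation space. -/
theorem IsCalderon.norm_interp_le_rpow {f : ℂ → S} {g : (ℝ →ᵇ X₀) × (ℝ →ᵇ X₁)}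
    (h : C.IsCalderon f g) {θ : Set.Ioo (0 : ℝ) 1} {x : C.interpSpace θ}
    (hx : C.incl θ x = f (θ : ℝ)) {M₀ M₁ : ℝ} (p₀ : 0 < M₀) (p₁ : 0 < M₁)
    (h₀ : ∀ y, ‖g.1 y‖ ≤ M₀) (h₁ : ∀ y, ‖g.2 y‖ ≤ M₁) :
    ‖x‖ ≤ M₀ ^ (1 - (θ : ℝ)) * M₁ ^ (θ : ℝ) := by
  obtain ⟨f', g', hc, e, e₀, e₁⟩ := h.exists_rescale θ (div_pos p₀ p₁)
  have hp := div_pos p₀ p₁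
  refine hc.norm_interp_le (hx.trans e.symm) (fun y => ?_) fun y => ?_
  · rw [e₀, ← (rpow_balance p₀ p₁).1]
    exact mul_le_mul_of_nonneg_left (h₀ y) (by positivity)
  · rw [e₁, ← (rpow_balance p₀ p₁).2]
    exact mul_le_mul_of_nonneg_left (h₁ y) (by positivity)

/-- Multiplication by `exp (z ^ 2 - θ ^ 2)` keeps the value at `θ` and makes the boundary functions
vanish at infinity. -/
theorem IsCalderon.exists_damp {f : ℂ → S} {g : (ℝ →ᵇ X₀) × (ℝ →ᵇ X₁)} (h : C.IsCalderon f g)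
    (θ : Set.Ioo (0 : ℝ) 1) :
    ∃ (f' : ℂ → S) (g' : (ℝ →ᵇ X₀) × (ℝ →ᵇ X₁)), C.IsCalderon f' g' ∧
      f' (θ : ℝ) = f (θ : ℝ) ∧ (∀ y, ‖g'.1 y‖ ≤ Real.exp 1 * ‖g.1 y‖) ∧
      (∀ y, ‖g'.2 y‖ ≤ Real.exp 1 * ‖g.2 y‖) ∧
      Tendsto g'.1 (cocompact ℝ) (𝓝 0) ∧ Tendsto g'.2 (cocompact ℝ) (𝓝 0) := by
  set φ : ℂ → ℂ := fun z => Complex.exp (z ^ 2 - ((θ : ℝ) : ℂ) ^ 2) with hφ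
  have hn : ∀ z : ℂ, z.re ∈ Set.Icc (0 : ℝ) 1 →
      ‖φ z‖ ≤ Real.exp 1 * Real.exp (-z.im ^ 2) := fun z hz => by
    rw [hφ, Complex.norm_exp, ← Real.exp_add, Real.exp_le_exp]
    have : (z ^ 2 - ((θ : ℝ) : ℂ) ^ 2).re = z.re ^ 2 - z.im ^ 2 - (θ : ℝ) ^ 2 := by
      simp [pow_two]
    rw [this]
    nlinarith [hz.1, hz.2, sq_nonneg (θ : ℝ)]
  have hn1 : ∀ z : ℂ, z.re ∈ Set.Icc (0 : ℝ) 1 → ‖φ z‖ ≤ Real.exp 1 := fun z hz =>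
    (hn z hz).trans (mul_le_of_le_one_right (Real.exp_pos _).le
      (Real.exp_le_one_iff.2 (by nlinarith)))
  have hd : Differentiable ℂ φ := by fun_prop
  obtain ⟨g', hg', e₀, e₁⟩ := h.exists_mul (φ := φ) hd.continuous.continuousOn
    hd.differentiableOn ⟨Real.exp 1, hn1⟩
  have ht : ∀ c : ℝ, Tendsto (fun y : ℝ => Real.exp 1 * Real.exp (-y ^ 2) * c) (cocompact ℝ)
      (𝓝 0) := fun c => by
    have : Tendsto (fun y : ℝ => Real.exp (-y ^ 2)) (cocompact ℝ) (𝓝 0) := by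
      refine Real.tendsto_exp_atBot.comp ?_
      refine tendsto_neg_atTop_atBot.comp ?_
      have := (tendsto_pow_atTop (α := ℝ) two_ne_zero).comp (tendsto_norm_cocompact_atTop (E := ℝ))
      refine this.congr fun y => by simp
    simpa using (this.const_mul (Real.exp 1)).mul_const c
  refine ⟨_, g', hg', by simp [hφ], fun y => ?_, fun y => ?_, ?_, ?_⟩
  · rw [e₀, norm_smul]
    exact mul_le_mul_of_nonneg_right (hn1 _ (by simp)) (norm_nonneg _)
  · rw [e₁, norm_smul]
    exact mul_le_mul_of_nonneg_right (hn1 _ (by simp)) (norm_nonneg _)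
  · refine squeeze_zero_norm (fun y => ?_) (ht ‖g.1‖)
    rw [e₀, norm_smul]
    exact mul_le_mul ((hn _ (by simp)).trans_eq (by simp)) (g.1.norm_coe_le_norm y)
      (norm_nonneg _) (by positivity)
  · refine squeeze_zero_norm (fun y => ?_) (ht ‖g.2‖)
    rw [e₁, norm_smul]
    exact mul_le_mul ((hn _ (by simp)).trans_eq (by simp)) (g.2.norm_coe_le_norm y)
      (norm_nonneg _) (by positivity)

end InterpolationCouple

/-- Uniformly bounded operators which converge pointwise to the identity do so uniformly along a
curve which vanishes at infinity. -/
theorem exists_forall_norm_sub_le_of_tendsto_zero {X : Type*} [NormedAddCommGroup X]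
    [NormedSpace ℂ X] {T : ℕ → X →L[ℂ] X} {K : ℝ} (hK : ∀ n, ‖T n‖ ≤ K)
    (hT : ∀ x, Tendsto (fun n => T n x) atTop (𝓝 x)) {g : ℝ → X} (hg : Continuous g)
    (hg0 : Tendsto g (cocompact ℝ) (𝓝 0)) {ε : ℝ} (hε : 0 < ε) :
    ∃ N, ∀ n ≥ N, ∀ y, ‖g y - T n (g y)‖ ≤ ε := by
  have hK0 : 0 ≤ K := (norm_nonneg _).trans (hK 0)
  have key : ∀ n (a : X), ‖a - T n a‖ ≤ (1 + K) * ‖a‖ := fun n a => by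
    refine (norm_sub_le _ _).trans ?_
    have := (T n).le_of_opNorm_le (hK n) a
    linarith
  set δ := ε / (2 * (1 + K)) with hδ
  have hδ0 : 0 < δ := by positivity
  have hδe : (1 + K) * δ = ε / 2 := by rw [hδ]; field_simp
  obtain ⟨s, hs, hs'⟩ : ∃ s : Set ℝ, IsCompact s ∧ ∀ y ∉ s, ‖g y‖ < δ := by
    have := hg0.eventually (Metric.ball_mem_nhds (0 : X) hδ0)
    obtain ⟨s, hs, hsub⟩ := mem_cocompact.1 this
    exact ⟨s, hs, fun y hy => by simpa using hsub hy⟩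
  have hc : ∃ N, ∀ n ≥ N, ∀ y ∈ s, ‖g y - T n (g y)‖ ≤ ε := by
    refine hs.induction_on (p := fun s => ∃ N, ∀ n ≥ N, ∀ y ∈ s, ‖g y - T n (g y)‖ ≤ ε)
      ⟨0, by simp⟩ ?_ ?_ ?_
    · rintro s t hst ⟨N, hN⟩
      exact ⟨N, fun n hn y hy => hN n hn y (hst hy)⟩
    · rintro s t ⟨N, hN⟩ ⟨N', hN'⟩
      refine ⟨max N N', fun n hn y hy => ?_⟩
      rcases hy with hy | hy
      · exact hN n (le_of_max_le_left hn) y hy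
      · exact hN' n (le_of_max_le_right hn) y hy
    · intro y₀ _
      refine ⟨{y | ‖g y - g y₀‖ < δ}, ?_, ?_⟩
      · refine mem_nhdsWithin_of_mem_nhds ?_
        have := hg.continuousAt.eventually (Metric.ball_mem_nhds (g y₀) hδ0)
        filter_upwards [this] with y hy
        simpa [dist_eq_norm] using hy
      · have h1 := (hT (g y₀)).eventually (Metric.ball_mem_nhds (g y₀) (half_pos hε))
        obtain ⟨N, hN⟩ := eventually_atTop.1 h1
        refine ⟨N, fun n hn y hy => ?_⟩
        have h2 : ‖g y₀ - T n (g y₀)‖ < ε / 2 := by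
          have := hN n hn
          rwa [dist_comm, dist_eq_norm] at this
        have h3 := key n (g y - g y₀)
        have h4 : (1 + K) * ‖g y - g y₀‖ ≤ ε / 2 := by
          rw [← hδe]
          exact mul_le_mul_of_nonneg_left (le_of_lt hy) (by positivity)
        calc ‖g y - T n (g y)‖
            = ‖(g y - g y₀ - T n (g y - g y₀)) + (g y₀ - T n (g y₀))‖ := by
              rw [map_sub]; congr 1; abel
          _ ≤ _ := norm_add_le _ _
          _ ≤ ε := by linarith
  obtain ⟨N, hN⟩ := hc
  refine ⟨N, fun n hn y => ?_⟩
  by_cases hy : y ∈ s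
  · exact hN n hn y hy
  · refine (key n (g y)).trans ?_
    have := mul_le_mul_of_nonneg_left (hs' y hy).le (show 0 ≤ 1 + K by positivity)
    linarith

namespace InterpolationCouple

variable {X₀ X₁ S : Type*}
  [NormedAddCommGroup X₀] [NormedSpace ℂ X₀] [CompleteSpace X₀]
  [NormedAddCommGroup X₁] [NormedSpace ℂ X₁] [CompleteSpace X₁]
  [NormedAddCommGroup S] [NormedSpace ℂ S] [CompleteSpace S]
  {C : InterpolationCouple X₀ X₁ S}

/-! ### The common basis in the interpolation space -/

variable (C) in
/-- Operators on `X₀` and `X₁` which agree on `X₀ ∩ X₁` extend to the sum; the extension is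
continuous by the open mapping theorem. -/
theorem exists_extend_sum {F : Type*} [NormedAddCommGroup F] [NormedSpace ℂ F]
    (T₀ : X₀ →L[ℂ] F) (T₁ : X₁ →L[ℂ] F)
    (h : ∀ x₀ x₁, C.i₀ x₀ = C.i₁ x₁ → T₀ x₀ = T₁ x₁) :
    ∃ T : S →L[ℂ] F, (∀ x, T (C.i₀ x) = T₀ x) ∧ ∀ x, T (C.i₁ x) = T₁ x := by
  set p : X₀ × X₁ →L[ℂ] S := C.i₀.coprod C.i₁ with hp
  set q : X₀ × X₁ →L[ℂ] F := T₀.coprod T₁ with hq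
  have hsurj : Function.Surjective p := fun s => by
    obtain ⟨x₀, x₁, hs⟩ := C.sum_eq s
    exact ⟨(x₀, x₁), by simpa [hp] using hs⟩
  have hker : ∀ a, p a = 0 → q a = 0 := fun a ha => by
    have : C.i₀ a.1 = C.i₁ (-a.2) := by
      rw [map_neg]; exact eq_neg_of_add_eq_zero_left (by simpa [hp] using ha)
    have := h _ _ this
    simp [hq, this]
  obtain ⟨r, hr⟩ := LinearMap.exists_rightInverse_of_surjective (p : X₀ × X₁ →ₗ[ℂ] S)
    (LinearMap.range_eq_top.2 hsurj)
  have hr' : ∀ s, p (r s) = s := fun s => LinearMap.congr_fun hr s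
  have hφ : ∀ a, q (r (p a)) = q a := fun a => by
    -- `r (p a)` and `a` differ by an element of `X₀ ∩ X₁`, on which `T₀` and `T₁` agree
    have := hker (r (p a) - a) (by rw [map_sub, hr', sub_self])
    rwa [map_sub, sub_eq_zero] at this
  have hcont : Continuous ((q : X₀ × X₁ →ₗ[ℂ] F) ∘ₗ r) := by
    rw [(IsOpenMap.isQuotientMap (p.isOpenMap hsurj) p.continuous hsurj).continuous_iff]
    refine q.continuous.congr fun a => (hφ a).symm
  refine ⟨⟨(q : X₀ × X₁ →ₗ[ℂ] F) ∘ₗ r, hcont⟩, fun x => ?_, fun x => ?_⟩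
  · have := hφ (x, 0)
    simp only [hp, ContinuousLinearMap.coprod_apply, map_zero, add_zero] at this
    simpa [hq] using this
  · have := hφ (0, x)
    simp only [hp, ContinuousLinearMap.coprod_apply, map_zero, zero_add] at this
    simpa [hq] using this

namespace IsCommonBasis

variable {L : SummationFilter ℕ} {e₀ : GeneralSchauderBasis ℕ ℂ X₀ L}
  {e₁ : GeneralSchauderBasis ℕ ℂ X₁ L} (h : C.IsCommonBasis e₀ e₁)

/-- The coordinate functionals of the common basis, on the sum `X₀ + X₁`. -/
def sumCoord (n : ℕ) : S →L[ℂ] ℂ :=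
  (C.exists_extend_sum (e₀.coord n) (e₁.coord n) fun x₀ x₁ hx => h.coord_eq x₀ x₁ hx n).choose

theorem sumCoord_left (n : ℕ) (x : X₀) : h.sumCoord n (C.i₀ x) = e₀.coord n x :=
  (C.exists_extend_sum (e₀.coord n) (e₁.coord n)
    fun x₀ x₁ hx => h.coord_eq x₀ x₁ hx n).choose_spec.1 x

theorem sumCoord_right (n : ℕ) (x : X₁) : h.sumCoord n (C.i₁ x) = e₁.coord n x :=
  (C.exists_extend_sum (e₀.coord n) (e₁.coord n)
    fun x₀ x₁ hx => h.coord_eq x₀ x₁ hx n).choose_spec.2 x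

/-- The basis projection onto the coordinates in `A`, on the sum `X₀ + X₁`. -/
def sumProj (A : Finset ℕ) : S →L[ℂ] S := ∑ n ∈ A, (h.sumCoord n).smulRight (C.i₀ (e₀ n))

theorem sumProj_apply (A : Finset ℕ) (s : S) :
    h.sumProj A s = ∑ n ∈ A, h.sumCoord n s • C.i₀ (e₀ n) := by
  simp [sumProj]

theorem sumProj_left (A : Finset ℕ) (x : X₀) : h.sumProj A (C.i₀ x) = C.i₀ (e₀.proj A x) := by
  simp [sumProj_apply, sumCoord_left]

theorem sumProj_right (A : Finset ℕ) (x : X₁) : h.sumProj A (C.i₁ x) = C.i₁ (e₁.proj A x) := by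
  simp [sumProj_apply, sumCoord_right, h.basis_eq]

theorem incl_vec (θ : Set.Ioo (0 : ℝ) 1) (n : ℕ) : C.incl θ (h.vec θ n) = C.i₀ (e₀ n) :=
  IsCalderon.eq_extend (g := ⟨_, _, C.isCalderon_const (h.basis_eq n)⟩)
    (C.isCalderon_const (h.basis_eq n)) (re_mem_Icc θ)

/-- The basis projection onto the coordinates in `A`, on `X_θ`. -/
def interpProj (θ : Set.Ioo (0 : ℝ) 1) (A : Finset ℕ) : C.interpSpace θ →L[ℂ] C.interpSpace θ :=
  ∑ n ∈ A, ((h.sumCoord n).comp (C.incl θ)).smulRight (h.vec θ n)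

theorem interpProj_apply (θ : Set.Ioo (0 : ℝ) 1) (A : Finset ℕ) (x : C.interpSpace θ) :
    h.interpProj θ A x = ∑ n ∈ A, h.sumCoord n (C.incl θ x) • h.vec θ n := by
  simp [interpProj]

theorem incl_interpProj (θ : Set.Ioo (0 : ℝ) 1) (A : Finset ℕ) (x : C.interpSpace θ) :
    C.incl θ (h.interpProj θ A x) = h.sumProj A (C.incl θ x) := by
  simp [interpProj_apply, sumProj_apply, incl_vec]

/-- Basis projections are interpolated. -/
theorem norm_interpProj_le (θ : Set.Ioo (0 : ℝ) 1) {A : Finset ℕ} {K : ℝ}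
    (h₀ : ‖e₀.proj A‖ ≤ K) (h₁ : ‖e₁.proj A‖ ≤ K) : ‖h.interpProj θ A‖ ≤ K := by
  have hK : 0 ≤ K := (norm_nonneg _).trans h₀
  refine ContinuousLinearMap.opNorm_le_bound _ hK fun x => ?_
  have key : ∀ ε : ℝ, 0 < ε → ‖h.interpProj θ A x‖ ≤ K * (‖x‖ + ε) := fun ε hε => by
    obtain ⟨f, g, hf, hx, b₀, b₁⟩ := exists_isCalderon x hε
    refine (hf.map (h.sumProj_left A) (h.sumProj_right A)).norm_interp_le
      (by rw [incl_interpProj, hx]) (fun y => ?_) fun y => ?_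
    · exact ((e₀.proj A).le_of_opNorm_le h₀ (g.1 y)).trans (mul_le_mul_of_nonneg_left (b₀ y) hK)
    · exact ((e₁.proj A).le_of_opNorm_le h₁ (g.2 y)).trans (mul_le_mul_of_nonneg_left (b₁ y) hK)
  have ht : Tendsto (fun ε : ℝ => K * (‖x‖ + ε)) (𝓝[>] 0) (𝓝 (K * (‖x‖ + 0))) :=
    ((continuous_const.mul (continuous_const.add continuous_id)).tendsto 0).mono_left
      nhdsWithin_le_nhds
  rw [add_zero] at ht
  exact ge_of_tendsto ht (eventually_mem_nhdsWithin.mono fun ε hε => key ε hε)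

end IsCommonBasis

namespace IsCommonBasis

variable {e₀ : SchauderBasis ℂ X₀} {e₁ : SchauderBasis ℂ X₁} (h : C.IsCommonBasis e₀ e₁)

/-- The partial sums converge in `X_θ`: for a Calderón function which vanishes at infinity on the
boundary, they converge uniformly on the boundary. -/
theorem tendsto_interpProj (θ : Set.Ioo (0 : ℝ) 1) (x : C.interpSpace θ) :
    Tendsto (fun n => h.interpProj θ (Finset.range n) x) atTop (𝓝 x) := by
  obtain ⟨f, g, hf, hx, -, -⟩ := exists_isCalderon x one_pos
  obtain ⟨f', g', hf', hx', -, -, t₀, t₁⟩ := hf.exists_damp θ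
  obtain ⟨K₀, hK₀⟩ := SchauderBasis.exists_norm_proj_le e₀
  obtain ⟨K₁, hK₁⟩ := SchauderBasis.exists_norm_proj_le e₁
  refine Metric.tendsto_atTop'.2 fun ε hε => ?_
  obtain ⟨N₀, hN₀⟩ := exists_forall_norm_sub_le_of_tendsto_zero hK₀
    (SchauderBasis.tendsto_proj e₀) g'.1.continuous t₀ (half_pos hε)
  obtain ⟨N₁, hN₁⟩ := exists_forall_norm_sub_le_of_tendsto_zero hK₁
    (SchauderBasis.tendsto_proj e₁) g'.2.continuous t₁ (half_pos hε)
  refine ⟨max N₀ N₁, fun n hn => ?_⟩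
  rw [dist_comm, dist_eq_norm]
  refine lt_of_le_of_lt ?_ (half_lt_self hε)
  have hm := hf'.map (h.sumProj_left (Finset.range n)) (h.sumProj_right (Finset.range n))
  refine (hf'.add (hm.smul (-1))).norm_interp_le ?_ (fun y => ?_) fun y => ?_
  · simp [incl_interpProj, hx', hx, sub_eq_add_neg]
  · have := hN₀ n ((le_max_left _ _).trans hn.le) y
    simpa [sub_eq_add_neg, SchauderBasis.proj] using this
  · have := hN₁ n ((le_max_right _ _).trans hn.le) y
    simpa [sub_eq_add_neg, SchauderBasis.proj] using this

/-- The common basis is a Schauder basis of `X_θ`. -/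
def interpBasis (θ : Set.Ioo (0 : ℝ) 1) : SchauderBasis ℂ (C.interpSpace θ) where
  basis := h.vec θ
  coord n := (h.sumCoord n).comp (C.incl θ)
  ortho i j := by
    rw [ContinuousLinearMap.comp_apply, incl_vec, sumCoord_left, e₀.ortho]
  expansion x := by
    rw [HasSum, SummationFilter.conditional_filter_eq_map_range, tendsto_map'_iff]
    exact (h.tendsto_interpProj θ x).congr fun n => by simp [interpProj_apply]

end IsCommonBasis

/-- Three lines theorem for sums of vectors supported in given finite sets: the basis projections of
Calderón functions of the vectors are again Calderón functions of the vectors. Norms at most `1 / 2`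
leave room to choose the Calderón functions with boundary norms at most `1`. -/
theorem IsCommonBasis.norm_sum_le_rpow {L : SummationFilter ℕ} {e₀ : GeneralSchauderBasis ℕ ℂ X₀ L}
    {e₁ : GeneralSchauderBasis ℕ ℂ X₁ L} (h : C.IsCommonBasis e₀ e₁) (θ : Set.Ioo (0 : ℝ) 1)
    {ι : Type*} [Fintype ι] (A : ι → Finset ℕ) {M₀ M₁ : ℝ} (p₀ : 0 < M₀) (p₁ : 0 < M₁)
    (h₀ : ∀ a : ι → X₀, (∀ j, ‖a j‖ ≤ 1) → ‖∑ j, e₀.proj (A j) (a j)‖ ≤ M₀)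
    (h₁ : ∀ a : ι → X₁, (∀ j, ‖a j‖ ≤ 1) → ‖∑ j, e₁.proj (A j) (a j)‖ ≤ M₁)
    {x : ι → C.interpSpace θ} (hx : ∀ j, ‖x j‖ ≤ 1 / 2)
    (hA : ∀ j, h.interpProj θ (A j) (x j) = x j) :
    ‖∑ j, x j‖ ≤ M₀ ^ (1 - (θ : ℝ)) * M₁ ^ (θ : ℝ) := by
  choose f g hf hfx b₀ b₁ using fun j => exists_isCalderon (x j) (ε := 1 / 2) (by norm_num)
  have hs := IsCalderon.sum Finset.univ fun j (_ : j ∈ Finset.univ) =>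
    (hf j).map (h.sumProj_left (A j)) (h.sumProj_right (A j))
  refine hs.norm_interp_le_rpow ?_ p₀ p₁ (fun y => ?_) fun y => ?_
  · simp only [map_sum, Finset.sum_apply, hfx, ← incl_interpProj, hA]
  · have := h₀ (fun j => (g j).1 y) fun j => (b₀ j y).trans (by linarith [hx j])
    simpa [Prod.fst_sum, BoundedContinuousFunction.sum_apply] using this
  · have := h₁ (fun j => (g j).2 y) fun j => (b₁ j y).trans (by linarith [hx j])
    simpa [Prod.snd_sum, BoundedContinuousFunction.sum_apply] using this

end InterpolationCouple

/-! ### Block sequences in infinite-dimensional subspaces -/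

namespace GeneralSchauderBasis

variable {E : Type*} [NormedAddCommGroup E] [NormedSpace ℂ E] {L : SummationFilter ℕ}
  (b : GeneralSchauderBasis ℕ ℂ E L)

theorem proj_eq_self_of_mem_span {A B : Finset ℕ} (hAB : A ⊆ B) {x : E}
    (hx : x ∈ Submodule.span ℂ (b '' (A : Set ℕ))) : b.proj B x = x := by
  rw [← range_proj_eq_span] at hx
  obtain ⟨z, rfl⟩ := hx
  rw [ContinuousLinearMap.coe_coe, proj_comp]
  congr 2
  ext i
  simpa using @hAB i

theorem coord_eq_zero_of_mem_span {A : Finset ℕ} {n : ℕ} (hn : n ∉ A) {x : E}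
    (hx : x ∈ Submodule.span ℂ (b '' (A : Set ℕ))) : b.coord n x = 0 := by
  rw [← b.proj_eq_self_of_mem_span subset_rfl hx, proj_apply, map_sum]
  refine Finset.sum_eq_zero fun i hi => ?_
  have hne : n ≠ i := fun h => hn (h ▸ hi)
  have h0 : b.coord n (b i) = 0 := by
    rw [b.ortho]
    convert Pi.single_eq_of_ne (M := fun _ : ℕ => ℂ) hne 1
    rfl
  rw [map_smul, h0, smul_zero]

theorem proj_eq_zero_of_mem_span {A B : Finset ℕ} (hAB : Disjoint A B) {x : E}
    (hx : x ∈ Submodule.span ℂ (b '' (A : Set ℕ))) : b.proj B x = 0 := by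
  rw [proj_apply]
  refine Finset.sum_eq_zero fun i hi => ?_
  rw [b.coord_eq_zero_of_mem_span (Finset.disjoint_right.1 hAB hi) hx, zero_smul]

theorem proj_mem_span (A : Finset ℕ) (x : E) :
    b.proj A x ∈ Submodule.span ℂ (b '' (A : Set ℕ)) := by
  rw [← range_proj_eq_span]
  exact ⟨x, rfl⟩

end GeneralSchauderBasis

theorem span_image_mono {E : Type*} [AddCommGroup E] [Module ℂ E] (e : ℕ → E) {A B : Set ℕ}
    (h : A ⊆ B) : Submodule.span ℂ (e '' A) ≤ Submodule.span ℂ (e '' B) :=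
  Submodule.span_mono (Set.image_mono h)

namespace SchauderBasis

variable {E F : Type*} [NormedAddCommGroup E] [NormedSpace ℂ E]
  [NormedAddCommGroup F] [NormedSpace ℂ F]

theorem proj_mem_span_Ico (b : SchauderBasis ℂ E) {m : ℕ} {x : E} (hx : ∀ i < m, b.coord i x = 0)
    (N : ℕ) : b.proj N x ∈ Submodule.span ℂ (b '' (Finset.Ico m N : Set ℕ)) := by
  rw [proj_apply]
  refine Submodule.sum_mem _ fun i hi => ?_
  rcases lt_or_ge i m with h | h
  · rw [hx i h, zero_smul]; exact Submodule.zero_mem _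
  · exact Submodule.smul_mem _ _ (Submodule.subset_span
      ⟨i, by simpa [h] using hi, rfl⟩)

/-- An infinite-dimensional subspace contains a vector which is close to a finitely supported vector
far out, and whose image under a given operator is so too. -/
theorem exists_near_block (b : SchauderBasis ℂ E) (b' : SchauderBasis ℂ F) {Y : Submodule ℂ E}
    (hY : ¬ FiniteDimensional ℂ Y) (T : Y →L[ℂ] F) (m : ℕ) {δ : ℝ} (hδ : 0 < δ) :
    ∃ (N : ℕ) (y : Y) (u : E) (v : F), m < N ∧ ‖y‖ = 1 ∧
      u ∈ Submodule.span ℂ (b '' (Finset.Ico m N : Set ℕ)) ∧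
      v ∈ Submodule.span ℂ (b' '' (Finset.Ico m N : Set ℕ)) ∧
      ‖(y : E) - u‖ ≤ δ ∧ ‖T y - v‖ ≤ δ := by
  -- finitely many linear conditions have a nonzero solution
  obtain ⟨y, hy0, hy, hTy⟩ : ∃ y : Y, y ≠ 0 ∧ (∀ i < m, b.coord i y = 0) ∧
      ∀ i < m, b'.coord i (T y) = 0 := by
    by_contra! hcon
    let Φ : Y →ₗ[ℂ] (Fin m → ℂ) × (Fin m → ℂ) :=
      (LinearMap.pi fun i : Fin m => (b.coord i : E →ₗ[ℂ] ℂ) ∘ₗ Y.subtype).prod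
        (LinearMap.pi fun i : Fin m => (b'.coord i : F →ₗ[ℂ] ℂ) ∘ₗ (T : Y →ₗ[ℂ] F))
    refine hY (Module.Finite.of_injective Φ ?_)
    rw [← LinearMap.ker_eq_bot, LinearMap.ker_eq_bot']
    intro y hy
    by_contra hne
    have h1 : ∀ i < m, b.coord i y = 0 := fun i hi =>
      congrFun (congrArg Prod.fst hy) ⟨i, hi⟩
    obtain ⟨i, hi, hi'⟩ := hcon y hne h1
    exact hi' (congrFun (congrArg Prod.snd hy) ⟨i, hi⟩)
  have hn : ‖y‖ ≠ 0 := norm_ne_zero_iff.2 hy0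
  set z : Y := ((‖y‖⁻¹ : ℝ) : ℂ) • y with hz
  have hz1 : ‖z‖ = 1 := by
    rw [hz, norm_smul, Complex.norm_real, norm_inv, norm_norm, inv_mul_cancel₀ hn]
  have h1 := (tendsto_proj b (z : E)).eventually (Metric.ball_mem_nhds _ hδ)
  have h2 := (tendsto_proj b' (T z)).eventually (Metric.ball_mem_nhds _ hδ)
  obtain ⟨N, h1, h2, h3⟩ := (h1.and (h2.and (eventually_gt_atTop m))).exists
  refine ⟨N, z, b.proj N z, b'.proj N (T z), h3, hz1, b.proj_mem_span_Ico (fun i hi => ?_) N,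
    b'.proj_mem_span_Ico (fun i hi => ?_) N, ?_, ?_⟩
  · rw [hz, Submodule.coe_smul, map_smul, hy i hi, smul_zero]
  · rw [hz, map_smul, map_smul, hTy i hi, smul_zero]
  · rw [← dist_eq_norm, dist_comm]; exact le_of_lt h1
  · rw [← dist_eq_norm, dist_comm]; exact le_of_lt h2

/-- Differences of partial sum projections single out the blocks of a linear combination. -/
theorem proj_sub_proj_sum_blocks (b : SchauderBasis ℂ E) {m : ℕ → ℕ} (hm : StrictMono m) {u : ℕ → E}
    (hu : ∀ k, u k ∈ Submodule.span ℂ (b '' (Finset.Ico (m k) (m (k + 1)) : Set ℕ)))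
    (s : Finset ℕ) (a : ℕ → ℂ) {k : ℕ} (hk : k ∈ s) :
    b.proj (m (k + 1)) (∑ i ∈ s, a i • u i) - b.proj (m k) (∑ i ∈ s, a i • u i) = a k • u k := by
  have h1 : ∀ i n, m (i + 1) ≤ n → b.proj n (u i) = u i := fun i n hn =>
    GeneralSchauderBasis.proj_eq_self_of_mem_span b (fun j hj => by
      simp only [Finset.mem_Ico, Finset.mem_range] at hj ⊢; omega) (hu i)
  have h2 : ∀ i n, n ≤ m i → b.proj n (u i) = 0 := fun i n hn =>
    GeneralSchauderBasis.proj_eq_zero_of_mem_span b (Finset.disjoint_left.2 fun j hj => by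
      simp only [Finset.mem_Ico, Finset.mem_range] at hj ⊢; omega) (hu i)
  rw [map_sum, map_sum, ← Finset.sum_sub_distrib, Finset.sum_eq_single_of_mem k hk]
  · rw [map_smul, map_smul, h1 k _ le_rfl, h2 k _ le_rfl, smul_zero, sub_zero]
  · intro i _ hik
    rcases lt_or_gt_of_ne hik with h | h
    · rw [map_smul, map_smul, h1 i _ (hm.monotone (by omega)), h1 i _ (hm.monotone (by omega)),
        sub_self]
    · rw [map_smul, map_smul, h2 i _ (hm.monotone (by omega)), h2 i _ (hm.monotone (by omega)),
        sub_self]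

/-- A gliding hump in two spaces at once: if an infinite-dimensional subspace of `E` is isomorphically
embedded in `F`, there are equivalent block sequences in `E` and in `F` whose supports are contained
in the same intervals. The perturbations in both spaces are absorbed by the bound which the basis of
`E` gives for the coefficients, so that nothing is required of the basis projections of `F`. -/
theorem exists_equivalent_blocks (b : SchauderBasis ℂ E) (b' : SchauderBasis ℂ F) {K : ℝ}
    (hK : ∀ n, ‖b.proj n‖ ≤ K) {Y : Submodule ℂ E} (hY : ¬ FiniteDimensional ℂ Y) (T : Y →L[ℂ] F)
    {c : ℝ} (hc : ∀ y, ‖y‖ ≤ c * ‖T y‖) :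
    ∃ (m : ℕ → ℕ) (u : ℕ → E) (v : ℕ → F) (D : ℝ), StrictMono m ∧
      (∀ k, u k ∈ Submodule.span ℂ (b '' (Finset.Ico (m k) (m (k + 1)) : Set ℕ))) ∧
      (∀ k, v k ∈ Submodule.span ℂ (b' '' (Finset.Ico (m k) (m (k + 1)) : Set ℕ))) ∧
      (∀ k, u k ≠ 0) ∧ 0 < D ∧
      ∀ (s : Finset ℕ) (a : ℕ → ℂ), ‖∑ k ∈ s, a k • u k‖ ≤ D * ‖∑ k ∈ s, a k • v k‖ ∧
        ‖∑ k ∈ s, a k • v k‖ ≤ D * ‖∑ k ∈ s, a k • u k‖ := by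
  wlog hK1 : 1 ≤ K generalizing K
  · exact this (fun n => (hK n).trans (le_max_left K 1)) (le_max_right K 1)
  wlog hc0 : 0 ≤ c generalizing c
  · exact this (fun y => (hc y).trans
      (mul_le_mul_of_nonneg_right (le_max_left c 0) (norm_nonneg _))) (le_max_right c 0)
  have hK0 : 0 < K := by linarith
  -- coefficients are at most `4 * K * ‖U‖`, so that errors of total size `δ` move the sums by at most
  -- `4 * K * δ * ‖U‖ = ‖U‖ / (4 * (1 + c))`, which survives multiplication by `c`
  set δ : ℝ := 1 / (16 * K * (1 + c)) with hδ
  have hδ0 : 0 < δ := by positivity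
  have hδK : 4 * K * δ = 1 / (4 * (1 + c)) := by rw [hδ]; field_simp; norm_num
  have hq : 1 / (4 * (1 + c)) ≤ 1 / 4 := by
    apply one_div_le_one_div_of_le <;> linarith
  have hδ1 : δ ≤ 1 / 16 := by nlinarith
  choose N y u v hN hy hu hv hyu hyv using fun (k m : ℕ) =>
    exists_near_block b b' hY T m (δ := δ / 2 / 2 ^ k) (by positivity)
  let m : ℕ → ℕ := fun n => Nat.rec 0 N n
  have hms : ∀ k, m (k + 1) = N k (m k) := fun k => rfl
  have hm : StrictMono m := strictMono_nat_of_lt_succ fun k => by rw [hms]; exact hN k (m k)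
  have hδk : ∀ k : ℕ, δ / 2 / 2 ^ k ≤ 1 / 2 := fun k => by
    have : δ / 2 / 2 ^ k ≤ δ / 2 := div_le_self (by positivity) (one_le_pow₀ (by norm_num))
    linarith
  have hu2 : ∀ k, 1 / 2 ≤ ‖u k (m k)‖ := fun k => by
    have h1 : ‖(y k (m k) : E)‖ = 1 := hy k (m k)
    have h2 := norm_sub_norm_le (y k (m k) : E) (u k (m k))
    linarith [hyu k (m k), hδk k]
  have hblock : ∀ k, u k (m k) ∈ Submodule.span ℂ (b '' (Finset.Ico (m k) (m (k + 1)) : Set ℕ)) :=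
    fun k => hu k (m k)
  refine ⟨m, fun k => u k (m k), fun k => v k (m k), 2 * c + 2 * ‖T‖ + 1, hm, hblock,
    fun k => hv k (m k), fun k h0 => ?_, by positivity, fun s a => ?_⟩
  · have := hu2 k
    rw [show u k (m k) = 0 from h0, norm_zero] at this
    norm_num at this
  set U : E := ∑ k ∈ s, a k • u k (m k) with hU
  set V : F := ∑ k ∈ s, a k • v k (m k) with hV
  set Z : Y := ∑ k ∈ s, a k • y k (m k) with hZ
  have ha : ∀ k ∈ s, ‖a k‖ ≤ 4 * K * ‖U‖ := fun k hk => by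
    have h1 : ‖a k‖ * ‖u k (m k)‖ ≤ 2 * K * ‖U‖ := by
      rw [← norm_smul, ← b.proj_sub_proj_sum_blocks hm hblock s a hk]
      refine (norm_sub_le _ _).trans ?_
      have e1 := (b.proj (m (k + 1))).le_of_opNorm_le (hK _) U
      have e2 := (b.proj (m k)).le_of_opNorm_le (hK _) U
      linarith
    nlinarith [hu2 k, norm_nonneg (a k)]
  have hsum : ∑ k ∈ s, ‖a k‖ * (δ / 2 / 2 ^ k) ≤ 1 / (4 * (1 + c)) * ‖U‖ := by
    calc ∑ k ∈ s, ‖a k‖ * (δ / 2 / 2 ^ k)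
        ≤ ∑ k ∈ s, 4 * K * ‖U‖ * (δ / 2 / 2 ^ k) := Finset.sum_le_sum fun k hk =>
          mul_le_mul_of_nonneg_right (ha k hk) (by positivity)
      _ = 4 * K * ‖U‖ * ∑ k ∈ s, δ / 2 / 2 ^ k := by rw [Finset.mul_sum]
      _ ≤ 4 * K * ‖U‖ * δ := by
          refine mul_le_mul_of_nonneg_left ?_ (by positivity)
          have := (summable_geometric_two' δ).sum_le_tsum s fun k _ => by positivity
          rwa [tsum_geometric_two'] at this
      _ = _ := by rw [← hδK]; ring
  have h1 : ‖(Z : E) - U‖ ≤ 1 / (4 * (1 + c)) * ‖U‖ := by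
    refine le_trans ?_ hsum
    rw [hZ, hU, Submodule.coe_sum, ← Finset.sum_sub_distrib]
    refine norm_sum_le_of_le _ fun k _ => ?_
    rw [Submodule.coe_smul, ← smul_sub, norm_smul]
    exact mul_le_mul_of_nonneg_left (hyu k (m k)) (norm_nonneg _)
  have h2 : ‖T Z - V‖ ≤ 1 / (4 * (1 + c)) * ‖U‖ := by
    refine le_trans ?_ hsum
    rw [hZ, hV, map_sum, ← Finset.sum_sub_distrib]
    refine norm_sum_le_of_le _ fun k _ => ?_
    rw [map_smul, ← smul_sub, norm_smul]
    exact mul_le_mul_of_nonneg_left (hyv k (m k)) (norm_nonneg _)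
  have h3 : 1 / (4 * (1 + c)) * ‖U‖ ≤ 1 / 4 * ‖U‖ :=
    mul_le_mul_of_nonneg_right hq (norm_nonneg _)
  have h4 : c * (1 / (4 * (1 + c)) * ‖U‖) ≤ 1 / 4 * ‖U‖ := by
    rw [← mul_assoc]
    refine mul_le_mul_of_nonneg_right ?_ (norm_nonneg _)
    rw [mul_one_div, div_le_div_iff₀ (by positivity) (by norm_num)]
    linarith
  have hcZ : ‖(Z : E)‖ ≤ c * ‖T Z‖ := hc Z
  have hTZ : ‖T Z‖ ≤ ‖T‖ * ‖(Z : E)‖ := T.le_opNorm Z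
  have n1 := norm_sub_norm_le U (Z : E)
  rw [norm_sub_rev] at n1
  have n2 := norm_sub_norm_le (Z : E) U
  have n3 := norm_sub_norm_le (T Z) V
  have n4 := norm_sub_norm_le V (T Z)
  rw [norm_sub_rev] at n4
  have hU0 := norm_nonneg U
  have hV0 := norm_nonneg V
  have hT0 := norm_nonneg T
  constructor
  · have : c * ‖T Z‖ ≤ c * (‖V‖ + 1 / (4 * (1 + c)) * ‖U‖) :=
      mul_le_mul_of_nonneg_left (by linarith) hc0
    rw [mul_add] at this
    have h5 : ‖U‖ ≤ 2 * c * ‖V‖ := by linarith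
    nlinarith
  · have : ‖T‖ * ‖(Z : E)‖ ≤ ‖T‖ * (2 * ‖U‖) := mul_le_mul_of_nonneg_left (by linarith) hT0
    nlinarith

end SchauderBasis

/-! ### The parameters `π^M` and `π^A` -/

section Parameters

variable {E F : Type*} [NormedAddCommGroup E] [NormedSpace ℂ E]
  [NormedAddCommGroup F] [NormedSpace ℂ F]

theorem piM_le {u : ℕ → E} {n : ℕ} {M : ℝ} (hM : 0 ≤ M)
    (h : ∀ (A : Fin n → Finset ℕ) (x : Fin n → E), (∀ i j, i ≠ j → Disjoint (A i) (A j)) →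
      (∀ j, x j ∈ Submodule.span ℂ (u '' (A j : Set ℕ))) → (∀ j, ‖x j‖ ≤ 1) →
      ‖∑ j, x j‖ ≤ M) : piM u n ≤ M := by
  refine Real.sSup_le ?_ hM
  rintro _ ⟨A, x, h1, h2, h3, rfl⟩
  exact h A x h1 h2 h3

theorem piM_nonneg (u : ℕ → E) (n : ℕ) : 0 ≤ piM u n :=
  Real.sSup_nonneg (by rintro _ ⟨-, -, -, -, -, rfl⟩; positivity)

theorem piA_nonneg (e : ℕ → E) (W : Submodule ℂ E) (n : ℕ) : 0 ≤ piA e W n :=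
  Real.sSup_nonneg (by rintro _ ⟨-, -, -, -, -, -, rfl⟩; positivity)

theorem norm_sum_le_card {E : Type*} [NormedAddCommGroup E] {n : ℕ} {x : Fin n → E}
    (hx : ∀ j, ‖x j‖ ≤ 1) : ‖∑ j, x j‖ ≤ n := by
  simpa using norm_sum_le_of_le Finset.univ fun j _ => hx j

theorem norm_inv_smul_le {x : E} {M : ℝ} (hM : 0 < M) (hx : ‖x‖ ≤ M) :
    ‖((M⁻¹ : ℝ) : ℂ) • x‖ ≤ 1 := by
  rw [norm_smul, Complex.norm_real, norm_inv, Real.norm_of_nonneg hM.le, inv_mul_le_iff₀ hM,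
    mul_one]
  exact hx

theorem norm_sum_le_of_inv_smul {ι : Type*} {s : Finset ι} {x : ι → E} {M P : ℝ} (hM : 0 < M)
    (h : ‖∑ j ∈ s, ((M⁻¹ : ℝ) : ℂ) • x j‖ ≤ P) : ‖∑ j ∈ s, x j‖ ≤ M * P := by
  rwa [← Finset.smul_sum, norm_smul, Complex.norm_real, norm_inv, Real.norm_of_nonneg hM.le,
    inv_mul_le_iff₀ hM] at h

theorem norm_sum_le_mul_piM {u : ℕ → E} {n : ℕ} {M : ℝ} (hM : 0 < M) {A : Fin n → Finset ℕ}
    {x : Fin n → E} (hA : ∀ i j, i ≠ j → Disjoint (A i) (A j))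
    (hx : ∀ j, x j ∈ Submodule.span ℂ (u '' (A j : Set ℕ))) (hn : ∀ j, ‖x j‖ ≤ M) :
    ‖∑ j, x j‖ ≤ M * piM u n := by
  refine norm_sum_le_of_inv_smul hM (le_csSup ⟨n, ?_⟩ ?_)
  · rintro _ ⟨A, x, -, -, h3, rfl⟩
    exact norm_sum_le_card h3
  · exact ⟨A, _, hA, fun j => Submodule.smul_mem _ _ (hx j), fun j => norm_inv_smul_le hM (hn j),
      rfl⟩

theorem one_le_piM {u : ℕ → E} (hu : u 0 ≠ 0) {n : ℕ} (hn : 0 < n) : 1 ≤ piM u n := by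
  classical
  have hpos : 0 < ‖u 0‖ := norm_pos_iff.2 hu
  have := norm_sum_le_mul_piM (u := u) hpos (A := fun j : Fin n => if j = ⟨0, hn⟩ then {0} else ∅)
    (x := fun j => if j = ⟨0, hn⟩ then u 0 else 0) (fun i j hij => ?_) (fun j => ?_) fun j => ?_
  · rw [Finset.sum_ite_eq' Finset.univ, if_pos (Finset.mem_univ _)] at this
    exact (le_mul_iff_one_le_right hpos).1 this
  · by_cases hi : i = ⟨0, hn⟩
    · have hj : j ≠ ⟨0, hn⟩ := fun hj => hij (hi.trans hj.symm)
      simp [hj]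
    · simp [hi]
  · split_ifs
    · exact Submodule.subset_span ⟨0, by simp, rfl⟩
    · exact Submodule.zero_mem _
  · split_ifs
    · exact le_rfl
    · simp

theorem piA_le {e : ℕ → E} {W : Submodule ℂ E} {n : ℕ} {M : ℝ} (hM : 0 ≤ M)
    (h : ∀ (A : Fin n → Finset ℕ) (x : Fin n → E), (∀ j, ∀ k ∈ A j, n ≤ k) →
      (∀ i j, i < j → SetLT (A i) (A j)) → (∀ j, x j ∈ W) →
      (∀ j, x j ∈ Submodule.span ℂ (e '' (A j : Set ℕ))) → (∀ j, ‖x j‖ ≤ 1) →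
      ‖∑ j, x j‖ ≤ M) : piA e W n ≤ M := by
  refine Real.sSup_le ?_ hM
  rintro _ ⟨A, x, h1, h2, h3, h4, rfl⟩
  exact h A x h1 h2 (fun j => (h3 j).1) (fun j => (h3 j).2) h4

theorem norm_sum_le_mul_piA {e : ℕ → E} {n : ℕ} {M : ℝ} (hM : 0 < M) {A : Fin n → Finset ℕ}
    {x : Fin n → E} (hAn : ∀ j, ∀ k ∈ A j, n ≤ k) (hA : ∀ i j, i < j → SetLT (A i) (A j))
    (hx : ∀ j, x j ∈ Submodule.span ℂ (e '' (A j : Set ℕ))) (hn : ∀ j, ‖x j‖ ≤ M) :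
    ‖∑ j, x j‖ ≤ M * piA e ⊤ n := by
  refine norm_sum_le_of_inv_smul hM (le_csSup ⟨n, ?_⟩ ?_)
  · rintro _ ⟨A, x, -, -, -, h3, rfl⟩
    exact norm_sum_le_card h3
  · exact ⟨A, _, hAn, hA, fun j => ⟨trivial, Submodule.smul_mem _ _ (hx j)⟩,
      fun j => norm_inv_smul_le hM (hn j), rfl⟩

theorem one_le_piA {e : ℕ → E} {n : ℕ} (he : e n ≠ 0) (hn : 0 < n) : 1 ≤ piA e ⊤ n := by
  classical
  have hpos : 0 < ‖e n‖ := norm_pos_iff.2 he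
  have := norm_sum_le_mul_piA (e := e) hpos (A := fun j : Fin n => if j = ⟨0, hn⟩ then {n} else ∅)
    (x := fun j => if j = ⟨0, hn⟩ then e n else 0) (fun j k hk => ?_) (fun i j hij => ?_)
    (fun j => ?_) fun j => ?_
  · rw [Finset.sum_ite_eq' Finset.univ, if_pos (Finset.mem_univ _)] at this
    exact (le_mul_iff_one_le_right hpos).1 this
  · split_ifs at hk
    · exact (Finset.mem_singleton.1 hk).ge
    · simp at hk
  · have hj : j ≠ ⟨0, hn⟩ := fun hj => by
      rw [hj] at hij; exact absurd (Fin.lt_def.1 hij) (Nat.not_lt_zero _)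
    intro k _ l hl
    simp [hj] at hl
  · split_ifs
    · exact Submodule.subset_span ⟨n, by simp, rfl⟩
    · exact Submodule.zero_mem _
  · split_ifs
    · exact le_rfl
    · simp

theorem exists_sum_eq_of_mem_span_image {u : ℕ → E} {A : Finset ℕ} {x : E}
    (hx : x ∈ Submodule.span ℂ (u '' (A : Set ℕ))) :
    ∃ a : ℕ → ℂ, (∀ k ∉ A, a k = 0) ∧ ∀ s, A ⊆ s → ∑ k ∈ s, a k • u k = x := by
  classical
  obtain ⟨c, hc⟩ := (Submodule.mem_span_image_finset_iff_exists_fun ℂ).1 hx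
  refine ⟨fun k => if h : k ∈ A then c ⟨k, h⟩ else 0, fun k hk => dif_neg hk, fun s hs => ?_⟩
  rw [← Finset.sum_subset hs fun k _ hk => by simp [hk], ← hc,
    ← Finset.sum_coe_sort A]
  exact Finset.sum_congr rfl fun k _ => by simp

theorem sum_sum_smul {ι : Type*} (t : Finset ι) (s : Finset ℕ) (c : ι → ℕ → ℂ) (w : ℕ → E) :
    ∑ j ∈ t, ∑ k ∈ s, c j k • w k = ∑ k ∈ s, (∑ j ∈ t, c j k) • w k := by
  rw [Finset.sum_comm]
  simp only [Finset.sum_smul]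

/-- The parameter `π^M` of the span of `u` is dominated by that of a space containing an equivalent
block sequence `v`: disjoint families with respect to `v` are disjoint with respect to the basis. -/
theorem piM_le_of_equivalent_blocks {b' : ℕ → F} {m : ℕ → ℕ} (hm : StrictMono m) {u : ℕ → E}
    {v : ℕ → F} {D : ℝ} (hD : 0 < D)
    (hv : ∀ k, v k ∈ Submodule.span ℂ (b' '' (Finset.Ico (m k) (m (k + 1)) : Set ℕ)))
    (huv : ∀ (s : Finset ℕ) (a : ℕ → ℂ), ‖∑ k ∈ s, a k • u k‖ ≤ D * ‖∑ k ∈ s, a k • v k‖ ∧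
      ‖∑ k ∈ s, a k • v k‖ ≤ D * ‖∑ k ∈ s, a k • u k‖) (hb' : b' 0 ≠ 0) {n : ℕ} (hn : 0 < n) :
    piM u n ≤ D * (D * piM b' n) := by
  classical
  have hp := one_le_piM hb' hn
  refine piM_le (by positivity) fun A x hA hx hxn => ?_
  choose c hc0 hc using fun j => exists_sum_eq_of_mem_span_image (hx j)
  set s : Finset ℕ := Finset.univ.biUnion A with hs
  have hxs : ∀ j, ∑ k ∈ s, c j k • u k = x j := fun j =>
    hc j s (Finset.subset_biUnion_of_mem A (Finset.mem_univ j))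
  calc ‖∑ j, x j‖ = ‖∑ k ∈ s, (∑ j, c j k) • u k‖ := by rw [← sum_sum_smul]; simp only [hxs]
    _ ≤ D * ‖∑ k ∈ s, (∑ j, c j k) • v k‖ := (huv s _).1
    _ = D * ‖∑ j, ∑ k ∈ s, c j k • v k‖ := by rw [sum_sum_smul]
    _ ≤ D * (D * piM b' n) := by
      refine mul_le_mul_of_nonneg_left ?_ hD.le
      refine norm_sum_le_mul_piM hD
        (A := fun j => (A j).biUnion fun k => Finset.Ico (m k) (m (k + 1))) (fun i j hij => ?_)
        (fun j => ?_) fun j => ?_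
      · rw [Finset.disjoint_left]
        intro p hp hp'
        simp only [Finset.mem_biUnion, Finset.mem_Ico] at hp hp'
        obtain ⟨k, hk, h1, h2⟩ := hp
        obtain ⟨l, hl, h3, h4⟩ := hp'
        have hkl : k = l := by
          by_contra hne
          rcases lt_or_gt_of_ne hne with h | h
          · have := hm.monotone (show k + 1 ≤ l by omega); omega
          · have := hm.monotone (show l + 1 ≤ k by omega); omega
        exact Finset.disjoint_left.1 (hA i j hij) hk (hkl ▸ hl)
      · refine Submodule.sum_mem _ fun k _ => ?_
        by_cases hk : k ∈ A j
        swap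
        · rw [hc0 j k hk, zero_smul]; exact Submodule.zero_mem _
        refine Submodule.smul_mem _ _ (span_image_mono b' ?_ (hv k))
        exact_mod_cast Finset.subset_biUnion_of_mem (fun k => Finset.Ico (m k) (m (k + 1))) hk
      · refine (huv s (c j)).2.trans ?_
        rw [hxs]
        exact mul_le_of_le_one_right hD.le (hxn j)

/-- A finitely supported vector of the closed span of a block sequence is a finite linear
combination of the blocks. -/
theorem SchauderBasis.exists_sum_eq_of_mem_closedSpan (b : SchauderBasis ℂ E) {m : ℕ → ℕ}
    (hm : StrictMono m) {u : ℕ → E}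
    (hu : ∀ k, u k ∈ Submodule.span ℂ (b '' (Finset.Ico (m k) (m (k + 1)) : Set ℕ)))
    {A : Finset ℕ} {N : ℕ} (hA : A ⊆ Finset.range (m N)) {x : E} (hx : x ∈ closedSpan u)
    (hxA : x ∈ Submodule.span ℂ (b '' (A : Set ℕ))) :
    ∃ a : ℕ → ℂ, ∑ k ∈ Finset.range N, a k • u k = x := by
  -- the projection maps the closed span into a finite-dimensional, hence closed, span of blocks
  set V : Submodule ℂ E := Submodule.span ℂ (u '' (Finset.range N : Set ℕ)) with hV
  have : FiniteDimensional ℂ V := FiniteDimensional.span_of_finite ℂ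
    ((Finset.finite_toSet _).image u)
  have hle : closedSpan u ≤ V.comap (b.proj (m N) : E →ₗ[ℂ] E) := by
    refine Submodule.topologicalClosure_minimal _ ?_
      ((V.closed_of_finiteDimensional).preimage (b.proj (m N)).continuous)
    rw [Submodule.span_le]
    rintro _ ⟨k, rfl⟩
    change b.proj (m N) (u k) ∈ V
    rcases lt_or_ge k N with h | h
    · have e : b.proj (m N) (u k) = u k :=
        GeneralSchauderBasis.proj_eq_self_of_mem_span b (fun j hj => by
          have := hm.monotone (show k + 1 ≤ N by omega)
          simp only [Finset.mem_Ico, Finset.mem_range] at hj ⊢; omega) (hu k)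
      rw [e]
      exact Submodule.subset_span ⟨k, by simpa using h, rfl⟩
    · have e : b.proj (m N) (u k) = 0 :=
        GeneralSchauderBasis.proj_eq_zero_of_mem_span b (Finset.disjoint_left.2 fun j hj => by
          have := hm.monotone h
          simp only [Finset.mem_Ico, Finset.mem_range] at hj ⊢; omega) (hu k)
      rw [e]
      exact Submodule.zero_mem _
  have h1 : b.proj (m N) x ∈ V := hle hx
  have h2 : b.proj (m N) x = x := GeneralSchauderBasis.proj_eq_self_of_mem_span b hA hxA
  rw [h2] at h1
  obtain ⟨a, -, ha⟩ := exists_sum_eq_of_mem_span_image h1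
  exact ⟨a, ha _ subset_rfl⟩

/-- Successive families in the closed span of a block sequence, compared with the images in the span
of an equivalent block sequence supported in the same intervals.  At most one image can start too
early, and it is dropped. -/
theorem piA_closedSpan_le_of_equivalent_blocks (b : SchauderBasis ℂ E) {b' : ℕ → F} {m : ℕ → ℕ}
    (hm : StrictMono m) {u : ℕ → E} {v : ℕ → F} {D : ℝ} (hD : 0 < D)
    (hu : ∀ k, u k ∈ Submodule.span ℂ (b '' (Finset.Ico (m k) (m (k + 1)) : Set ℕ)))
    (hv : ∀ k, v k ∈ Submodule.span ℂ (b' '' (Finset.Ico (m k) (m (k + 1)) : Set ℕ)))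
    (hu0 : ∀ k, u k ≠ 0)
    (huv : ∀ (s : Finset ℕ) (a : ℕ → ℂ), ‖∑ k ∈ s, a k • u k‖ ≤ D * ‖∑ k ∈ s, a k • v k‖ ∧
      ‖∑ k ∈ s, a k • v k‖ ≤ D * ‖∑ k ∈ s, a k • u k‖) {n : ℕ} (hb' : b' n ≠ 0) (hn : 0 < n) :
    piA b (closedSpan u) n ≤ D * (D + D * piA b' ⊤ n) := by
  classical
  have hp := one_le_piA hb' hn
  refine piA_le (by positivity) fun A x hAn hA hxW hx hxn => ?_
  obtain ⟨N, hN⟩ : ∃ N, ∀ j, A j ⊆ Finset.range (m N) := by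
    obtain ⟨N, hN⟩ := (Finset.univ.biUnion A).exists_nat_subset_range
    exact ⟨N, fun j => (Finset.subset_biUnion_of_mem A (Finset.mem_univ j)).trans
      (hN.trans (Finset.range_mono (hm.id_le N)))⟩
  choose a ha using fun j => b.exists_sum_eq_of_mem_closedSpan hm hu (hN j) (hxW j) (hx j)
  -- a coordinate at which the block does not vanish
  have hl : ∀ k, ∃ l, m k ≤ l ∧ l < m (k + 1) ∧ b.coord l (u k) ≠ 0 := fun k => by
    by_contra! hcon
    refine hu0 k ?_
    rw [← GeneralSchauderBasis.proj_eq_self_of_mem_span b subset_rfl (hu k),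
      GeneralSchauderBasis.proj_apply]
    refine Finset.sum_eq_zero fun l hl => ?_
    rw [Finset.mem_Ico] at hl
    rw [hcon l hl.1 hl.2, zero_smul]
  choose l hl1 hl2 hl3 using hl
  have hmem : ∀ j, ∀ k ∈ Finset.range N, a j k ≠ 0 → l k ∈ A j := fun j k hk hak => by
    by_contra hlA
    have h0 := GeneralSchauderBasis.coord_eq_zero_of_mem_span b hlA (hx j)
    rw [← ha, map_sum, Finset.sum_eq_single_of_mem k hk, map_smul, smul_eq_mul] at h0
    · exact (mul_ne_zero hak (hl3 k)) h0
    · intro i _ hik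
      rw [map_smul, GeneralSchauderBasis.coord_eq_zero_of_mem_span b _ (hu i), smul_zero]
      rw [Finset.mem_Ico]
      rintro ⟨h1, h2⟩
      have := hl1 k
      have := hl2 k
      rcases lt_or_gt_of_ne hik with h | h
      · have := hm.monotone (show i + 1 ≤ k by omega); omega
      · have := hm.monotone (show k + 1 ≤ i by omega); omega
  -- the blocks which occur in `x j`
  set B : Fin n → Finset ℕ := fun j => (Finset.range N).filter fun k => a j k ≠ 0 with hB
  have hBl : ∀ j, ∀ k ∈ B j, l k ∈ A j := fun j k hk => by
    rw [hB, Finset.mem_filter] at hk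
    exact hmem j k hk.1 hk.2
  have hBlt : ∀ i j, i < j → ∀ k ∈ B i, ∀ k' ∈ B j, k < k' := fun i j hij k hk k' hk' => by
    have h1 := hA i j hij _ (hBl i k hk) _ (hBl j k' hk')
    by_contra hle
    rcases (not_lt.1 hle).lt_or_eq with h | h
    · have := hm.monotone (show k' + 1 ≤ k by omega)
      have := hl1 k
      have := hl2 k'
      omega
    · rw [h] at h1; exact lt_irrefl _ h1
  -- A block with `m k < n ≤ l k` may enter, whose image can start before `n`; everything after it
  -- starts at `n` or later.
  obtain ⟨j₀, hj₀⟩ : ∃ j₀, ∀ j, j ≠ j₀ → ∀ k ∈ B j, n ≤ m k := by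
    by_cases hbad : ∃ j, ∃ k ∈ B j, m k < n
    · obtain ⟨j₀, k₀, hk₀, hlt₀⟩ := hbad
      refine ⟨j₀, fun j hj k hk => ?_⟩
      have key : ∀ i j, i < j → ∀ k ∈ B i, ∀ k' ∈ B j, n ≤ m k' := fun i j hij k hk k' hk' => by
        have h1 := hm.monotone (show k + 1 ≤ k' from hBlt i j hij k hk k' hk')
        have h2 := hAn i _ (hBl i k hk)
        have := hl2 k
        omega
      rcases lt_or_gt_of_ne hj with h | h
      · have := key j j₀ h k hk k₀ hk₀; omega
      · exact key j₀ j h k₀ hk₀ k hk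
    · push Not at hbad
      exact ⟨⟨0, hn⟩, fun j _ => hbad j⟩
  set y : Fin n → F := fun j => ∑ k ∈ Finset.range N, a j k • v k with hy
  have hyn : ∀ j, ‖y j‖ ≤ D := fun j => by
    refine (huv _ (a j)).2.trans ?_
    rw [ha]
    exact mul_le_of_le_one_right hD.le (hxn j)
  have hys : ∀ j, y j ∈ Submodule.span ℂ
      (b' '' ((B j).biUnion fun k => Finset.Ico (m k) (m (k + 1)) : Finset ℕ)) := fun j => by
    refine Submodule.sum_mem _ fun k hk => ?_
    by_cases hak : a j k = 0
    · rw [hak, zero_smul]; exact Submodule.zero_mem _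
    · refine Submodule.smul_mem _ _ (span_image_mono b' ?_ (hv k))
      have hkB : k ∈ B j := by rw [hB, Finset.mem_filter]; exact ⟨hk, hak⟩
      exact_mod_cast Finset.subset_biUnion_of_mem (fun k => Finset.Ico (m k) (m (k + 1))) hkB
  have hrest : ‖∑ j, if j = j₀ then 0 else y j‖ ≤ D * piA b' ⊤ n := by
    refine norm_sum_le_mul_piA hD (A := fun j => if j = j₀ then ∅ else
      (B j).biUnion fun k => Finset.Ico (m k) (m (k + 1))) (fun j p hp => ?_) (fun i j hij => ?_)
      (fun j => ?_) fun j => ?_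
    · split_ifs at hp with h
      · simp at hp
      · simp only [Finset.mem_biUnion, Finset.mem_Ico] at hp
        obtain ⟨k, hk, h1, -⟩ := hp
        exact (hj₀ j h k hk).trans h1
    · intro p hp q hq
      split_ifs at hp hq
      any_goals simp at hp
      any_goals simp at hq
      obtain ⟨k, hk, -, h2⟩ := hp
      obtain ⟨k', hk', h3, -⟩ := hq
      have := hm.monotone (show k + 1 ≤ k' from
        hBlt i j hij k (by simpa [hB] using hk) k' (by simpa [hB] using hk'))
      omega
    · split_ifs
      · exact Submodule.zero_mem _
      · exact hys j
    · split_ifs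
      · simpa using hD.le
      · exact hyn j
  have hsplit : ∑ j, y j = y j₀ + ∑ j, if j = j₀ then 0 else y j := by
    have : ∀ j, y j = (if j = j₀ then y j₀ else 0) + if j = j₀ then 0 else y j := fun j => by
      split_ifs with h <;> simp [h]
    conv_lhs => rw [Finset.sum_congr rfl fun j _ => this j, Finset.sum_add_distrib]
    simp
  calc ‖∑ j, x j‖ = ‖∑ k ∈ Finset.range N, (∑ j, a j k) • u k‖ := by
        rw [← sum_sum_smul]; simp only [ha]
    _ ≤ D * ‖∑ k ∈ Finset.range N, (∑ j, a j k) • v k‖ := (huv _ _).1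
    _ = D * ‖∑ j, y j‖ := by rw [← sum_sum_smul]
    _ ≤ D * (D + D * piA b' ⊤ n) := by
      refine mul_le_mul_of_nonneg_left ?_ hD.le
      rw [hsplit]
      exact (norm_add_le _ _).trans (add_le_add (hyn j₀) hrest)

end Parameters

/-! ### Incomparability by the parameters `π^M` and `π^A` -/

/-- If `b / a` is unbounded, then `a ^ (1 - θ) * b ^ θ` is not dominated by `a ^ (1 - t) * b ^ t` for
`t < θ`: the quotient is `(b / a) ^ (θ - t)`. -/
theorem not_isBigO_of_limsup_eq_top {a b : ℕ → ℝ} (ha : ∀ n, 0 < n → 1 ≤ a n)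
    (hb : ∀ n, 0 < n → 1 ≤ b n)
    (hlim : limsup (fun n : ℕ => ((b n / a n : ℝ) : EReal)) atTop = ⊤) {t θ : ℝ} (h : t < θ) :
    ¬ (fun n => a n ^ (1 - θ) * b n ^ θ) =O[atTop] fun n => a n ^ (1 - t) * b n ^ t := by
  intro hO
  obtain ⟨D, hD, hO⟩ := hO.exists_pos
  have hfreq : ∃ᶠ n : ℕ in atTop, ((D ^ (θ - t)⁻¹ : ℝ) : EReal) < ((b n / a n : ℝ) : EReal) :=
    frequently_lt_of_lt_limsup (by isBoundedDefault) (by rw [hlim]; exact EReal.coe_lt_top _)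
  obtain ⟨n, hn, hle, hn0⟩ := (hfreq.and_eventually
    (hO.bound.and (eventually_gt_atTop 0))).exists
  have a0 : 0 < a n := zero_lt_one.trans_le (ha n hn0)
  have b0 : 0 < b n := zero_lt_one.trans_le (hb n hn0)
  have hs : 0 < θ - t := sub_pos.2 h
  have e : ∀ s : ℝ, a n ^ (1 - s) * b n ^ s = a n * (b n / a n) ^ s := fun s => by
    rw [Real.div_rpow b0.le a0.le, Real.rpow_sub a0, Real.rpow_one]; ring
  rw [Real.norm_of_nonneg (by positivity), Real.norm_of_nonneg (by positivity), e, e,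
    mul_left_comm, mul_le_mul_iff_right₀ a0] at hle
  have hr : 0 < b n / a n := div_pos b0 a0
  have h1 : (b n / a n) ^ (θ - t) ≤ D := by
    rw [Real.rpow_sub hr, div_le_iff₀ (Real.rpow_pos_of_pos hr t)]
    exact hle
  have h2 : D < (b n / a n) ^ (θ - t) := by
    have := Real.rpow_lt_rpow (by positivity) (EReal.coe_lt_coe_iff.1 hn) hs
    rwa [← Real.rpow_mul hD.le, inv_mul_cancel₀ hs.ne', Real.rpow_one] at this
  exact absurd h1 (not_le.2 h2)

/-- An unconditional basis, as a Schauder basis. -/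
def UnconditionalSchauderBasis.toSchauderBasis {X : Type*} [NormedAddCommGroup X] [NormedSpace ℂ X]
    (e : UnconditionalSchauderBasis ℕ ℂ X) : SchauderBasis ℂ X where
  basis := e.basis
  coord := e.coord
  ortho := e.ortho
  expansion x := by
    rw [HasSum, SummationFilter.conditional_filter_eq_map_range, tendsto_map'_iff]
    exact HasSum.tendsto_sum_nat (e.expansion x)

/-- It is enough to exclude operators bounded below: the range of an embedding plays no role. -/
theorem TotallyIncomparable.of_forall_embedding {E F : Type*} [NormedAddCommGroup E]
    [NormedSpace ℂ E] [NormedAddCommGroup F] [NormedSpace ℂ F]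
    (h : ∀ Y : Submodule ℂ E, IsClosed (Y : Set E) → ¬ FiniteDimensional ℂ Y →
      ∀ (T : Y →L[ℂ] F) (c : ℝ), ¬ ∀ y, ‖y‖ ≤ c * ‖T y‖) : TotallyIncomparable E F := by
  rintro ⟨Y, Z, hYc, -, hY, ⟨e⟩⟩
  refine h Y hYc hY (Z.subtypeL ∘L (e : Y →L[ℂ] Z)) ‖(e.symm : Z →L[ℂ] Y)‖ fun y => ?_
  simpa using (e.symm : Z →L[ℂ] Y).le_opNorm (e y)

theorem mul_rpow_mul_mul_rpow {K a b t : ℝ} (hK : 0 < K) (ha : 0 ≤ a) (hb : 0 ≤ b) :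
    (K * a) ^ (1 - t) * (K * b) ^ t = K * (a ^ (1 - t) * b ^ t) := by
  rw [Real.mul_rpow hK.le ha, Real.mul_rpow hK.le hb, Real.rpow_sub hK, Real.rpow_one]
  have := (Real.rpow_pos_of_pos hK t).ne'
  field_simp

theorem SchauderBasis.norm_proj_Ico_le {X : Type*} [NormedAddCommGroup X] [NormedSpace ℂ X]
    (e : SchauderBasis ℂ X) {K : ℝ} (hK : ∀ n, ‖e.proj n‖ ≤ K) {p q : ℕ} (hpq : p ≤ q) :
    ‖GeneralSchauderBasis.proj e (Finset.Ico p q)‖ ≤ 2 * K := by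
  have : GeneralSchauderBasis.proj e (Finset.Ico p q) = e.proj q - e.proj p := by
    ext x
    rw [sub_apply, GeneralSchauderBasis.proj_apply, SchauderBasis.proj_apply,
      SchauderBasis.proj_apply, Finset.sum_Ico_eq_sub _ hpq]
  rw [this]
  exact (norm_sub_le _ _).trans (by linarith [hK p, hK q])

/-- Finite sets which are successive and bounded below lie in successive intervals. -/
theorem exists_Ico_of_setLT {n : ℕ} {A : Fin n → Finset ℕ} {N : ℕ} (hAN : ∀ j, ∀ k ∈ A j, N ≤ k)
    (hA : ∀ i j, i < j → SetLT (A i) (A j)) :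
    ∃ p q : Fin n → ℕ, (∀ j, N ≤ p j) ∧ (∀ j, p j ≤ q j) ∧ (∀ i j, i < j → q i ≤ p j) ∧
      ∀ j, A j ⊆ Finset.Ico (p j) (q j) := by
  classical
  -- `β j` bounds the first `j` sets, and is the left end of the next interval
  set β : ℕ → ℕ := fun j => max N ((Finset.univ.filter fun i : Fin n => (i : ℕ) < j).sup
    fun i => (A i).sup Nat.succ) with hβ
  have hβm : Monotone β := fun i j hij => max_le_max le_rfl (Finset.sup_mono fun k hk => by
    simp only [Finset.mem_filter, Finset.mem_univ, true_and] at hk ⊢; omega)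
  refine ⟨fun j => β j, fun j => β (j + 1), fun j => le_max_left _ _, fun j => hβm (Nat.le_succ _),
    fun i j hij => hβm hij, fun j k hk => Finset.mem_Ico.2 ⟨max_le (hAN j k hk) ?_, ?_⟩⟩
  · refine Finset.sup_le fun i hi => Finset.sup_le fun l hl => ?_
    exact hA i j (by simpa using hi) l hl k hk
  · refine Nat.lt_of_succ_le (le_trans ?_ (le_max_right _ _))
    exact (Finset.le_sup (f := Nat.succ) hk).trans
      (Finset.le_sup (f := fun i => (A i).sup Nat.succ) (by simp))

theorem setLT_Ico {m : ℕ → ℕ} (hm : StrictMono m) {i j : ℕ} (hij : i < j) :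
    SetLT (Finset.Ico (m i) (m (i + 1))) (Finset.Ico (m j) (m (j + 1))) := fun k hk l hl => by
  have := hm.monotone (show i + 1 ≤ j from hij)
  rw [Finset.mem_Ico] at hk hl
  omega

namespace InterpolationCouple

variable {X₀ X₁ S : Type*}
  [NormedAddCommGroup X₀] [NormedSpace ℂ X₀] [CompleteSpace X₀]
  [NormedAddCommGroup X₁] [NormedSpace ℂ X₁] [CompleteSpace X₁]
  [NormedAddCommGroup S] [NormedSpace ℂ S] [CompleteSpace S]
  {C : InterpolationCouple X₀ X₁ S}

namespace IsCommonBasis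

variable {e₀ : SchauderBasis ℂ X₀} {e₁ : SchauderBasis ℂ X₁} (h : C.IsCommonBasis e₀ e₁)

theorem vec_ne_zero (t : Set.Ioo (0 : ℝ) 1) (n : ℕ) : h.vec t n ≠ 0 :=
  (GeneralSchauderBasis.linearIndependent (h.interpBasis t)).ne_zero n

theorem interpProj_eq_self {t : Set.Ioo (0 : ℝ) 1} {A B : Finset ℕ} (hAB : A ⊆ B)
    {x : C.interpSpace t} (hx : x ∈ Submodule.span ℂ (h.vec t '' (A : Set ℕ))) :
    h.interpProj t B x = x :=
  GeneralSchauderBasis.proj_eq_self_of_mem_span (h.interpBasis t) hAB hx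

theorem exists_norm_interpBasis_proj_le (θ : Set.Ioo (0 : ℝ) 1) :
    ∃ K, ∀ n, ‖(h.interpBasis θ).proj n‖ ≤ K := by
  obtain ⟨K₀, hK₀⟩ := SchauderBasis.exists_norm_proj_le e₀
  obtain ⟨K₁, hK₁⟩ := SchauderBasis.exists_norm_proj_le e₁
  exact ⟨max K₀ K₁, fun n => h.norm_interpProj_le θ ((hK₀ n).trans (le_max_left _ _))
    ((hK₁ n).trans (le_max_right _ _))⟩

/-- The parameter `π^M` of the interpolation space is dominated by the interpolated parameters. -/
theorem piM_vec_le (t : Set.Ioo (0 : ℝ) 1) {K : ℝ} (hK : 0 < K)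
    (h₀ : ∀ A, ‖GeneralSchauderBasis.proj e₀ A‖ ≤ K)
    (h₁ : ∀ A, ‖GeneralSchauderBasis.proj e₁ A‖ ≤ K) {n : ℕ} (hn : 0 < n) :
    piM (h.vec t) n ≤ 2 * K * (piM e₀ n ^ (1 - (t : ℝ)) * piM e₁ n ^ (t : ℝ)) := by
  have p₀ := one_le_piM ((GeneralSchauderBasis.linearIndependent e₀).ne_zero 0) hn
  have p₁ := one_le_piM ((GeneralSchauderBasis.linearIndependent e₁).ne_zero 0) hn
  refine piM_le (by positivity) fun A x hA hx hxn => ?_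
  rw [mul_assoc, ← mul_rpow_mul_mul_rpow hK (by positivity) (by positivity)]
  refine norm_sum_le_of_inv_smul two_pos (h.norm_sum_le_rpow t A (by positivity) (by positivity)
    (fun a ha => ?_) (fun a ha => ?_) (fun j => ?_) fun j => ?_)
  · exact norm_sum_le_mul_piM hK hA (fun j => GeneralSchauderBasis.proj_mem_span e₀ _ _)
      fun j => ((GeneralSchauderBasis.proj e₀ (A j)).le_of_opNorm_le (h₀ _) _).trans
        (mul_le_of_le_one_right hK.le (ha j))
  · exact norm_sum_le_mul_piM hK hA (fun j => GeneralSchauderBasis.proj_mem_span e₁ _ _)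
      fun j => ((GeneralSchauderBasis.proj e₁ (A j)).le_of_opNorm_le (h₁ _) _).trans
        (mul_le_of_le_one_right hK.le (ha j))
  · rw [norm_smul, Complex.norm_real]
    norm_num
    linarith [hxn j]
  · rw [map_smul, h.interpProj_eq_self subset_rfl (hx j)]

/-- The parameter `π^A` of the interpolation space is dominated by the interpolated parameters. -/
theorem piA_vec_le (t : Set.Ioo (0 : ℝ) 1) {K : ℝ} (hK : 0 < K) (h₀ : ∀ n, ‖e₀.proj n‖ ≤ K)
    (h₁ : ∀ n, ‖e₁.proj n‖ ≤ K) {n : ℕ} (hn : 0 < n) :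
    piA (h.vec t) ⊤ n ≤ 2 * (2 * K) * (piA e₀ ⊤ n ^ (1 - (t : ℝ)) * piA e₁ ⊤ n ^ (t : ℝ)) := by
  have p₀ := one_le_piA ((GeneralSchauderBasis.linearIndependent e₀).ne_zero n) hn
  have p₁ := one_le_piA ((GeneralSchauderBasis.linearIndependent e₁).ne_zero n) hn
  have hK2 : 0 < 2 * K := by positivity
  refine piA_le (by positivity) fun A x hAn hA _ hx hxn => ?_
  obtain ⟨p, q, hp, hpq, hqp, hAI⟩ := exists_Ico_of_setLT hAn hA
  have hI : ∀ j, ∀ k ∈ Finset.Ico (p j) (q j), n ≤ k := fun j k hk =>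
    (hp j).trans (Finset.mem_Ico.1 hk).1
  have hIlt : ∀ i j, i < j → SetLT (Finset.Ico (p i) (q i)) (Finset.Ico (p j) (q j)) :=
    fun i j hij k hk l hl =>
      ((Finset.mem_Ico.1 hk).2.trans_le (hqp i j hij)).trans_le (Finset.mem_Ico.1 hl).1
  rw [mul_assoc, ← mul_rpow_mul_mul_rpow hK2 (by positivity) (by positivity)]
  refine norm_sum_le_of_inv_smul two_pos (h.norm_sum_le_rpow t
    (fun j => Finset.Ico (p j) (q j)) (by positivity) (by positivity)
    (fun a ha => ?_) (fun a ha => ?_) (fun j => ?_) fun j => ?_)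
  · exact norm_sum_le_mul_piA hK2 hI hIlt (fun j => GeneralSchauderBasis.proj_mem_span e₀ _ _)
      fun j => (ContinuousLinearMap.le_of_opNorm_le _
        (SchauderBasis.norm_proj_Ico_le e₀ h₀ (hpq j)) _).trans (mul_le_of_le_one_right hK2.le (ha j))
  · exact norm_sum_le_mul_piA hK2 hI hIlt (fun j => GeneralSchauderBasis.proj_mem_span e₁ _ _)
      fun j => (ContinuousLinearMap.le_of_opNorm_le _
        (SchauderBasis.norm_proj_Ico_le e₁ h₁ (hpq j)) _).trans (mul_le_of_le_one_right hK2.le (ha j))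
  · rw [norm_smul, Complex.norm_real]
    norm_num
    linarith [hxn j]
  · rw [map_smul, h.interpProj_eq_self (hAI j) (hx j)]

end IsCommonBasis

/-- Only the lower estimate of `π^M` on the subspaces of `X_θ` matters. -/
theorem totallyIncomparable_of_piM (θ : Set.Ioo (0 : ℝ) 1) (e₀ : UnconditionalSchauderBasis ℕ ℂ X₀)
    (e₁ : UnconditionalSchauderBasis ℕ ℂ X₁) (he : C.IsCommonBasis e₀ e₁)
    (hlim : limsup (fun n : ℕ => ((piM e₁ n / piM e₀ n : ℝ) : EReal)) atTop = ⊤)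
    (hθ : ∀ w : ℕ → C.interpSpace θ, DisjointlySupported (he.vec θ) w →
      (fun n => piM e₀ n ^ (1 - (θ : ℝ)) * piM e₁ n ^ (θ : ℝ)) =O[atTop] piM w)
    {t : Set.Ioo (0 : ℝ) 1} (ht : t < θ) :
    TotallyIncomparable (C.interpSpace θ) (C.interpSpace t) := by
  refine TotallyIncomparable.of_forall_embedding fun Y _ hY T c hc => ?_
  have h : C.IsCommonBasis e₀.toSchauderBasis e₁.toSchauderBasis := ⟨he.basis_eq, he.coord_eq⟩
  obtain ⟨K, hK⟩ := h.exists_norm_interpBasis_proj_le θ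
  obtain ⟨m, u, v, D, hm, hu, hv, hu0, hD, huv⟩ :=
    (h.interpBasis θ).exists_equivalent_blocks (h.interpBasis t) hK hY T hc
  have hds : DisjointlySupported (he.vec θ) u := by
    refine ⟨fun k => Finset.Ico (m k) (m (k + 1)), fun i j hij => ?_, fun i =>
      ⟨hu0 i, Submodule.le_topologicalClosure _ (hu i)⟩⟩
    refine Set.disjoint_left.2 fun p hp hq => ?_
    rcases lt_or_gt_of_ne hij with hij | hij
    · exact lt_irrefl p (setLT_Ico hm hij p hp p hq)
    · exact lt_irrefl p (setLT_Ico hm hij p hq p hp)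
  obtain ⟨K₀, hK₀⟩ := UnconditionalSchauderBasis.exists_norm_proj_le e₀
  obtain ⟨K₁, hK₁⟩ := UnconditionalSchauderBasis.exists_norm_proj_le e₁
  set M := max (max K₀ K₁) 1 with hM
  have hM0 : 0 < M := zero_lt_one.trans_le (le_max_right _ _)
  have p₀ : ∀ n, 0 < n → 1 ≤ piM e₀ n := fun n hn =>
    one_le_piM ((GeneralSchauderBasis.linearIndependent e₀).ne_zero 0) hn
  have p₁ : ∀ n, 0 < n → 1 ≤ piM e₁ n := fun n hn =>
    one_le_piM ((GeneralSchauderBasis.linearIndependent e₁).ne_zero 0) hn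
  refine not_isBigO_of_limsup_eq_top p₀ p₁ hlim ht ((hθ u hds).trans ?_)
  refine IsBigO.of_bound (D * (D * (2 * M))) ((eventually_gt_atTop 0).mono fun n hn => ?_)
  have q₀ := p₀ n hn
  have q₁ := p₁ n hn
  have h1 := piM_le_of_equivalent_blocks hm hD hv huv (h.vec_ne_zero t 0) hn
  have h2 := h.piM_vec_le t hM0
    (fun A => (hK₀ A).trans ((le_max_left _ _).trans (le_max_left _ _)))
    (fun A => (hK₁ A).trans ((le_max_right _ _).trans (le_max_left _ _))) hn
  rw [Real.norm_of_nonneg (piM_nonneg _ _),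
    Real.norm_of_nonneg (by positivity)]
  refine h1.trans ?_
  rw [mul_assoc, mul_assoc]
  exact mul_le_mul_of_nonneg_left (mul_le_mul_of_nonneg_left h2 hD.le) hD.le

/-- Only the lower estimate of `π^A` on the block subspaces of `X_θ` matters. -/
theorem totallyIncomparable_of_piA (θ : Set.Ioo (0 : ℝ) 1) (e₀ : SchauderBasis ℂ X₀)
    (e₁ : SchauderBasis ℂ X₁) (h : C.IsCommonBasis e₀ e₁)
    (hlim : limsup (fun n : ℕ => ((piA e₁ ⊤ n / piA e₀ ⊤ n : ℝ) : EReal)) atTop = ⊤)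
    (hθ : ∀ w : ℕ → C.interpSpace θ, IsBlockSequence (h.vec θ) w →
      (fun n => piA e₀ ⊤ n ^ (1 - (θ : ℝ)) * piA e₁ ⊤ n ^ (θ : ℝ)) =O[atTop]
        piA (h.vec θ) (closedSpan w))
    {t : Set.Ioo (0 : ℝ) 1} (ht : t < θ) :
    TotallyIncomparable (C.interpSpace θ) (C.interpSpace t) := by
  refine TotallyIncomparable.of_forall_embedding fun Y _ hY T c hc => ?_
  obtain ⟨K, hK⟩ := h.exists_norm_interpBasis_proj_le θ
  obtain ⟨m, u, v, D, hm, hu, hv, hu0, hD, huv⟩ :=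
    (h.interpBasis θ).exists_equivalent_blocks (h.interpBasis t) hK hY T hc
  have hbs : IsBlockSequence (h.vec θ) u :=
    ⟨fun k => Finset.Ico (m k) (m (k + 1)), fun i j hij => setLT_Ico hm hij,
      fun i => ⟨hu0 i, hu i⟩⟩
  obtain ⟨K₀, hK₀⟩ := SchauderBasis.exists_norm_proj_le e₀
  obtain ⟨K₁, hK₁⟩ := SchauderBasis.exists_norm_proj_le e₁
  set M := max (max K₀ K₁) 1 with hM
  have hM0 : 0 < M := zero_lt_one.trans_le (le_max_right _ _)
  have p₀ : ∀ n, 0 < n → 1 ≤ piA e₀ ⊤ n := fun n hn =>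
    one_le_piA ((GeneralSchauderBasis.linearIndependent e₀).ne_zero n) hn
  have p₁ : ∀ n, 0 < n → 1 ≤ piA e₁ ⊤ n := fun n hn =>
    one_le_piA ((GeneralSchauderBasis.linearIndependent e₁).ne_zero n) hn
  refine not_isBigO_of_limsup_eq_top p₀ p₁ hlim ht ((hθ u hbs).trans ?_)
  refine IsBigO.of_bound (D * (D + D * (2 * (2 * M)))) ((eventually_gt_atTop 0).mono fun n hn => ?_)
  have q₀ := p₀ n hn
  have q₁ := p₁ n hn
  have h1 := piA_closedSpan_le_of_equivalent_blocks (h.interpBasis θ) hm hD hu hv hu0 huv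
    (h.vec_ne_zero t n) hn
  have h2 := h.piA_vec_le t hM0
    (fun A => (hK₀ A).trans ((le_max_left _ _).trans (le_max_left _ _)))
    (fun A => (hK₁ A).trans ((le_max_right _ _).trans (le_max_left _ _))) hn
  have h3 : 1 ≤ piA e₀ ⊤ n ^ (1 - (t : ℝ)) * piA e₁ ⊤ n ^ (t : ℝ) :=
    one_le_mul_of_one_le_of_one_le (Real.one_le_rpow q₀ (by linarith [t.2.2]))
      (Real.one_le_rpow q₁ t.2.1.le)
  rw [Real.norm_of_nonneg (piA_nonneg _ _ _),
    Real.norm_of_nonneg (by positivity)]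
  refine h1.trans ?_
  rw [mul_assoc]
  refine mul_le_mul_of_nonneg_left ?_ hD.le
  rw [add_mul, mul_assoc]
  exact add_le_add (le_mul_of_one_le_right hD.le h3) (mul_le_mul_of_nonneg_left h2 hD.le)

end InterpolationCouple

/-! ### Families of Calderón functions which are summable on the boundary -/

/-- The Poisson kernel of a half-plane, summed over equidistant points: a bound which does not depend
on the mesh `δ`. The terms with `m ≥ 1` are majorized by a telescoping sum. -/
theorem sum_poisson_le {δ a : ℝ} (hδ : 0 < δ) (ha : 0 < a) (n : ℕ) :
    ∑ m ∈ Finset.range (n + 1), δ * (a + δ) / ((a + δ) ^ 2 + (δ * m) ^ 2) ≤ 3 := by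
  set τ := a + δ with hτ
  have hτ0 : 0 < τ := by positivity
  have key : ∑ m ∈ Finset.range (n + 1), δ * τ / (τ ^ 2 + (δ * m) ^ 2) ≤
      3 - 2 * τ / (τ + δ * n) := by
    induction n with
    | zero =>
      have h1 : δ * τ / (τ ^ 2 + (δ * (0 : ℕ)) ^ 2) ≤ 1 := by
        rw [div_le_one (by positivity)]
        push_cast
        nlinarith
      have h2 : 2 * τ / (τ + δ * (0 : ℕ)) = 2 := by
        push_cast
        field_simp
        simp
      rw [Finset.sum_range_one, h2]
      linarith
    | succ n ih =>
      rw [Finset.sum_range_succ]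
      have hs : 0 < τ + δ * n := by positivity
      have h1 : δ * τ / (τ ^ 2 + (δ * (n + 1 : ℕ)) ^ 2) ≤
          2 * τ / (τ + δ * n) - 2 * τ / (τ + δ * (n + 1 : ℕ)) := by
        push_cast
        have e : 2 * τ / (τ + δ * n) - 2 * τ / (τ + δ * (n + 1)) =
            2 * τ * δ / ((τ + δ * n) * (τ + δ * (n + 1))) := by
          rw [div_sub_div _ _ hs.ne' (by positivity)]
          congr 1
          ring
        rw [e, div_le_div_iff₀ (by positivity) (by positivity)]
        have h2 : (τ + δ * n) * (τ + δ * (n + 1)) ≤ 2 * (τ ^ 2 + (δ * (n + 1)) ^ 2) := by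
          nlinarith [sq_nonneg (τ - δ * (n + 1)), mul_pos hδ hs, mul_pos hδ hτ0,
            mul_nonneg hδ.le (mul_nonneg hδ.le (Nat.cast_nonneg (α := ℝ) n))]
        nlinarith [mul_le_mul_of_nonneg_left h2 (mul_pos hδ hτ0).le]
      linarith
  have : 0 ≤ 2 * τ / (τ + δ * n) := by positivity
  linarith

/-- Analytic functions with nonnegative real part on a half-plane whose real parts almost majorize
given boundary functions, and whose values at a given point are controlled by the sum of the
boundary functions. They are discretized Herglotz integrals. -/
theorem exists_herglotz_majorant {ι : Type*} [Fintype ι] {α : ι → ℝ → ℝ}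
    (hc : ∀ i, Continuous (α i)) (h0 : ∀ i, Tendsto (α i) (cocompact ℝ) (𝓝 0))
    (hp : ∀ i y, 0 ≤ α i y) {A : ℝ} (hA : ∀ y, ∑ i, α i y ≤ A) {a η : ℝ} (ha : 0 < a)
    (hη : 0 < η) :
    ∃ h : ι → ℂ → ℂ, (∀ i z, 0 ≤ z.re → DifferentiableAt ℂ (h i) z) ∧
      (∀ i z, 0 ≤ z.re → 0 ≤ (h i z).re) ∧ (∀ i (y : ℝ), α i y ≤ (h i (y * Complex.I)).re + η) ∧
      (∀ i, (h i a).im = 0) ∧ ∑ i, (h i a).re ≤ 12 * A := by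
  set β : ℝ → ι → ℝ := fun y i => α i y with hβ
  have hβc : Continuous β := continuous_pi hc
  have hβ0 : Tendsto β (cocompact ℝ) (𝓝 0) := tendsto_pi_nhds.2 h0
  obtain ⟨δ', hδ'0, hδ'⟩ := Metric.uniformContinuous_iff.1
    (hβc.uniformContinuous_of_tendsto_cocompact hβ0) η hη
  set δ := δ' / 2 with hδ
  have hδ0 : 0 < δ := half_pos hδ'0
  obtain ⟨R, hR⟩ : ∃ R : ℝ, ∀ y, R < |y| → ∀ i, α i y ≤ η := by
    obtain ⟨s, hs, hsub⟩ := mem_cocompact.1 (hβ0 (Metric.ball_mem_nhds (0 : ι → ℝ) hη))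
    obtain ⟨R, hR⟩ := hs.isBounded.subset_closedBall 0
    refine ⟨R, fun y hy i => ?_⟩
    have h1 : y ∉ s := fun h => by
      have := hR h
      rw [mem_closedBall_zero_iff, Real.norm_eq_abs] at this
      linarith
    have h2 : ‖β y‖ < η := by simpa using hsub h1
    exact (le_abs_self _).trans ((norm_le_pi_norm (β y) i).trans h2.le)
  -- The grid `± δ * m`, `m ≤ N`, covers `[-R, R]`; each half-plane kernel `k` has real part at least
  -- `1 / 2` within distance `δ` of its pole, which accounts for the factor `2` in the definition of
  -- `h`. The imaginary parts at `a` are subtracted to make `h i a` real.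
  set N := ⌈R / δ⌉₊ with hN
  set p : ℕ → ℤˣ → ℝ := fun m ε => ((ε : ℤ) : ℝ) * (δ * m) with hpdef
  have hp2 : ∀ m ε, p m ε ^ 2 = (δ * m) ^ 2 := fun m ε => by
    rcases Int.units_eq_one_or ε with rfl | rfl <;> simp [hpdef]
  set w : ℕ → ℤˣ → ℂ → ℂ := fun m ε z => z - p m ε * Complex.I + δ with hw
  have hwre : ∀ m ε z, (w m ε z).re = z.re + δ := fun m ε z => by simp [hw]
  have hwim : ∀ m ε z, (w m ε z).im = z.im - p m ε := fun m ε z => by simp [hw]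
  have hw0 : ∀ m ε z, 0 ≤ z.re → w m ε z ≠ 0 := fun m ε z hz h => by
    have := hwre m ε z
    rw [h, Complex.zero_re] at this
    linarith
  set k : ℕ → ℤˣ → ℂ → ℂ := fun m ε z => (δ : ℂ) * (w m ε z)⁻¹ with hk
  have hkre : ∀ m ε z, (k m ε z).re =
      δ * (z.re + δ) / ((z.re + δ) ^ 2 + (z.im - p m ε) ^ 2) := fun m ε z => by
    rw [hk, Complex.re_ofReal_mul, Complex.inv_re, Complex.normSq_apply, hwre, hwim]
    ring
  have hk0 : ∀ m ε z, 0 ≤ z.re → 0 ≤ (k m ε z).re := fun m ε z hz => by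
    rw [hkre]; positivity
  refine ⟨fun i z => ∑ m ∈ Finset.range (N + 1), ∑ ε : ℤˣ,
    ((2 * α i (p m ε) : ℝ) : ℂ) * (k m ε z - ((k m ε a).im : ℂ) * Complex.I),
    fun i z hz => ?_, fun i z hz => ?_, fun i y => ?_, fun i => ?_, ?_⟩
  · refine DifferentiableAt.fun_sum fun m _ => DifferentiableAt.fun_sum fun ε _ => ?_
    have : DifferentiableAt ℂ (w m ε) z := by
      rw [hw]; fun_prop
    exact (((this.inv (hw0 m ε z hz)).const_mul _).sub_const _).const_mul _
  · rw [Complex.re_sum]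
    refine Finset.sum_nonneg fun m _ => ?_
    rw [Complex.re_sum]
    refine Finset.sum_nonneg fun ε _ => ?_
    rw [Complex.re_ofReal_mul]
    have := hk0 m ε z hz
    have := hp i (p m ε)
    simp only [Complex.sub_re, Complex.mul_re, Complex.I_re, Complex.ofReal_im, Complex.I_im]
    nlinarith
  · have hterm : ∀ m ε, 0 ≤ (((2 * α i (p m ε) : ℝ) : ℂ) *
        (k m ε (y * Complex.I) - ((k m ε a).im : ℂ) * Complex.I)).re := fun m ε => by
      rw [Complex.re_ofReal_mul]
      have := hk0 m ε (y * Complex.I) (by simp)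
      have := hp i (p m ε)
      simp only [Complex.sub_re, Complex.mul_re, Complex.I_re, Complex.ofReal_im, Complex.I_im]
        at *
      nlinarith
    rw [Complex.re_sum]
    simp only [Complex.re_sum]
    rcases lt_or_ge R |y| with hy | hy
    · have := hR y hy i
      have := Finset.sum_nonneg fun m (_ : m ∈ Finset.range (N + 1)) =>
        Finset.sum_nonneg fun ε (_ : ε ∈ (Finset.univ : Finset ℤˣ)) => hterm m ε
      linarith
    · -- the nearest point of the grid between `0` and `y`
      obtain ⟨ε, hε⟩ : ∃ ε : ℤˣ, y = ((ε : ℤ) : ℝ) * |y| := by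
        rcases abs_choice y with h | h
        · exact ⟨1, by simp [h]⟩
        · exact ⟨-1, by simp [h]⟩
      set m := ⌊|y| / δ⌋₊ with hm
      have hm1 : δ * m ≤ |y| := by
        have := Nat.floor_le (show 0 ≤ |y| / δ by positivity)
        rw [← hm, le_div_iff₀ hδ0] at this
        linarith
      have hm2 : |y| < δ * m + δ := by
        have := Nat.lt_floor_add_one (|y| / δ)
        rw [← hm, div_lt_iff₀ hδ0] at this
        linarith
      have hmN : m ∈ Finset.range (N + 1) := by
        rw [Finset.mem_range, Nat.lt_succ_iff]
        exact (Nat.floor_le_ceil _).trans (Nat.ceil_mono (by gcongr))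
      have hd : |y - p m ε| ≤ δ := by
        have : y - p m ε = ((ε : ℤ) : ℝ) * (|y| - δ * m) := by
          rw [mul_sub, ← hε]
        rw [this, abs_mul]
        have h1 : |((ε : ℤ) : ℝ)| = 1 := by
          rcases Int.units_eq_one_or ε with rfl | rfl <;> simp
        rw [h1, one_mul, abs_le]
        constructor <;> linarith
      have hα : α i y ≤ α i (p m ε) + η := by
        have h1 : dist y (p m ε) < δ' := by
          rw [Real.dist_eq]; linarith [half_lt_self hδ'0]
        have h2 := (dist_le_pi_dist (β y) (β (p m ε)) i).trans (hδ' h1).le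
        rw [Real.dist_eq] at h2
        have := le_abs_self (β y i - β (p m ε) i)
        simp only [hβ] at this h2
        linarith
      have hhalf : 1 / 2 ≤ (k m ε (y * Complex.I)).re := by
        rw [hkre]
        have e1 : ((y : ℂ) * Complex.I).re = 0 := by simp
        have e2 : ((y : ℂ) * Complex.I).im = y := by simp
        rw [e1, e2, zero_add, div_le_div_iff₀ two_pos (by positivity)]
        have := sq_le_sq.2 (hd.trans (le_abs_self δ))
        nlinarith
      have hbig : α i (p m ε) ≤ (((2 * α i (p m ε) : ℝ) : ℂ) *
          (k m ε (y * Complex.I) - ((k m ε a).im : ℂ) * Complex.I)).re := by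
        rw [Complex.re_ofReal_mul]
        have := hp i (p m ε)
        simp only [Complex.sub_re, Complex.mul_re, Complex.I_re, Complex.ofReal_im, Complex.I_im]
          at *
        nlinarith
      have h1 := Finset.single_le_sum (fun ε' _ => hterm m ε') (Finset.mem_univ ε)
      have h2 := Finset.single_le_sum (f := fun m => ∑ ε : ℤˣ, (((2 * α i (p m ε) : ℝ) : ℂ) *
          (k m ε (y * Complex.I) - ((k m ε a).im : ℂ) * Complex.I)).re)
        (fun m' _ => Finset.sum_nonneg fun ε' _ => hterm m' ε') hmN
      linarith
  · rw [Complex.im_sum]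
    refine Finset.sum_eq_zero fun m _ => ?_
    rw [Complex.im_sum]
    refine Finset.sum_eq_zero fun ε _ => ?_
    rw [Complex.im_ofReal_mul]
    simp
  · simp only [Complex.re_sum, Complex.re_ofReal_mul]
    rw [Finset.sum_comm]
    have hA0 : 0 ≤ A := (Finset.sum_nonneg fun i _ => hp i 0).trans (hA 0)
    have hmain : ∀ m : ℕ, ∑ i, ∑ ε : ℤˣ, 2 * α i (p m ε) *
        (k m ε a - ((k m ε a).im : ℂ) * Complex.I).re ≤
        4 * A * (δ * (a + δ) / ((a + δ) ^ 2 + (δ * m) ^ 2)) := fun m => by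
      have hκ : ∀ ε, (k m ε a - ((k m ε a).im : ℂ) * Complex.I).re =
          δ * (a + δ) / ((a + δ) ^ 2 + (δ * m) ^ 2) := fun ε => by
        rw [Complex.sub_re, hkre]
        simp [hp2]
      simp only [hκ]
      set κ := δ * (a + δ) / ((a + δ) ^ 2 + (δ * m) ^ 2) with hκd
      have hκ0 : 0 ≤ κ := by positivity
      rw [Finset.sum_comm]
      calc ∑ ε : ℤˣ, ∑ i, 2 * α i (p m ε) * κ = ∑ ε : ℤˣ, 2 * (∑ i, α i (p m ε)) * κ := by
            refine Finset.sum_congr rfl fun ε _ => ?_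
            rw [Finset.mul_sum, Finset.sum_mul]
        _ ≤ ∑ ε : ℤˣ, 2 * A * κ := Finset.sum_le_sum fun ε _ =>
            mul_le_mul_of_nonneg_right (mul_le_mul_of_nonneg_left (hA _) zero_le_two) hκ0
        _ = 4 * A * κ := by
            rw [Finset.sum_const, Finset.card_univ, Fintype.card_units_int]
            simp; ring
    refine (Finset.sum_le_sum fun m _ => hmain m).trans ?_
    rw [← Finset.mul_sum]
    have := mul_le_mul_of_nonneg_left (sum_poisson_le hδ0 ha N) (show 0 ≤ 4 * A by positivity)
    linarith

namespace InterpolationCouple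

variable {X₀ X₁ S : Type*}
  [NormedAddCommGroup X₀] [NormedSpace ℂ X₀] [CompleteSpace X₀]
  [NormedAddCommGroup X₁] [NormedSpace ℂ X₁] [CompleteSpace X₁]
  [NormedAddCommGroup S] [NormedSpace ℂ S] [CompleteSpace S]
  {C : InterpolationCouple X₀ X₁ S}

/-- Interpolation of `ℓ¹`-sums: division of a Calderón function by an analytic function whose real
part majorizes its boundary norms gives a representative of norm controlled by an average of the
boundary norms. -/
theorem IsCalderon.sum_norm_interp_le {ι : Type*} [Fintype ι] {f : ι → ℂ → S}
    {g : ι → (ℝ →ᵇ X₀) × (ℝ →ᵇ X₁)} (h : ∀ i, C.IsCalderon (f i) (g i))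
    {t : Set.Ioo (0 : ℝ) 1} {x : ι → C.interpSpace t} (hx : ∀ i, C.incl t (x i) = f i (t : ℝ))
    {A : ℝ} (h₀ : ∀ y, ∑ i, ‖(g i).1 y‖ ≤ A) (h₁ : ∀ y, ∑ i, ‖(g i).2 y‖ ≤ A) :
    ∑ i, ‖x i‖ ≤ 24 * (Real.exp 1 * A) := by
  choose f' g' hc hv b₀ b₁ t₀ t₁ using fun i => (h i).exists_damp t
  have key : ∀ η : ℝ, 0 < η → ∑ i, ‖x i‖ ≤ 24 * (Real.exp 1 * A) + Fintype.card ι * η := by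
    intro η hη
    have sA : ∀ (a b : ι → ℝ), (∀ i, b i ≤ Real.exp 1 * a i) → ∑ i, a i ≤ A →
        ∑ i, b i ≤ Real.exp 1 * A := fun a b hab ha => by
      refine (Finset.sum_le_sum fun i _ => hab i).trans ?_
      rw [← Finset.mul_sum]
      exact mul_le_mul_of_nonneg_left ha (Real.exp_pos 1).le
    obtain ⟨u, ud, u0, ub, ui, us⟩ := exists_herglotz_majorant
      (α := fun i y => ‖(g' i).1 y‖) (fun i => (g' i).1.continuous.norm)
      (fun i => tendsto_zero_iff_norm_tendsto_zero.1 (t₀ i)) (fun i y => norm_nonneg _)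
      (fun y => sA _ _ (fun i => b₀ i y) (h₀ y)) t.2.1 hη
    obtain ⟨v, vd, v0, vb, vi, vs⟩ := exists_herglotz_majorant
      (α := fun i y => ‖(g' i).2 (-y)‖) (a := 1 - (t : ℝ))
      (fun i => ((g' i).2.continuous.comp continuous_neg).norm)
      (fun i => tendsto_zero_iff_norm_tendsto_zero.1 ((t₁ i).comp
        (Homeomorph.neg ℝ).isClosedEmbedding.tendsto_cocompact)) (fun i y => norm_nonneg _)
      (fun y => sA _ _ (fun i => b₁ i (-y)) (h₁ (-y))) (sub_pos.2 t.2.2) hη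
    -- the right boundary line is reflected to the left one by `z ↦ 1 - z`
    set H : ι → ℂ → ℂ := fun i z => (η : ℂ) + u i z + v i (1 - z) with hH
    set r : ι → ℝ := fun i => η + (u i (t : ℝ)).re + (v i ((1 - (t : ℝ) : ℝ) : ℂ)).re with hr
    have hHre : ∀ i z, (H i z).re = η + (u i z).re + (v i (1 - z)).re := fun i z => by simp [hH]
    have hHt : ∀ i, H i (t : ℝ) = (r i : ℂ) := fun i => by
      apply Complex.ext
      · simp [hH, hr]
      · have h1 := ui i
        have h2 := vi i
        push_cast at h2
        simp [hH, h1, h2]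
    have hHη : ∀ i z, z.re ∈ Set.Icc (0 : ℝ) 1 → η ≤ (H i z).re := fun i z hz => by
      have h1 := u0 i z hz.1
      have h2 := v0 i (1 - z) (by simp [hz.2])
      rw [hHre]
      linarith
    have hHne : ∀ i z, z.re ∈ Set.Icc (0 : ℝ) 1 → H i z ≠ 0 := fun i z hz h0 => by
      have := hHη i z hz
      rw [h0, Complex.zero_re] at this
      linarith
    have hHd : ∀ i z, z.re ∈ Set.Icc (0 : ℝ) 1 → DifferentiableAt ℂ (H i) z := fun i z hz => by
      have h1 := vd i (1 - z) (by simp [hz.2])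
      have h2 : DifferentiableAt ℂ (fun z => v i (1 - z)) z :=
        h1.comp z (differentiableAt_id.const_sub 1)
      exact ((ud i z hz.1).const_add _).add h2
    have hr0 : ∀ i, 0 < r i := fun i => by
      have := hHη i _ (re_mem_Icc t)
      rw [hHt, Complex.ofReal_re] at this
      linarith
    have hφd : ∀ i z, z.re ∈ Set.Icc (0 : ℝ) 1 →
        DifferentiableAt ℂ (fun z => (r i : ℂ) / H i z) z := fun i z hz =>
      (differentiableAt_const _).div (hHd i z hz) (hHne i z hz)
    have hφn : ∀ i z, z.re ∈ Set.Icc (0 : ℝ) 1 → ∀ s ≤ (H i z).re, 0 ≤ s →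
        ‖(r i : ℂ) / H i z‖ * s ≤ r i := fun i z hz s hs hs0 => by
      have h1 : (H i z).re ≤ ‖H i z‖ := Complex.re_le_norm _
      have h2 : 0 < ‖H i z‖ := norm_pos_iff.2 (hHne i z hz)
      rw [norm_div, Complex.norm_real, Real.norm_of_nonneg (hr0 i).le, div_mul_eq_mul_div,
        div_le_iff₀ h2]
      exact mul_le_mul_of_nonneg_left (hs.trans h1) (hr0 i).le
    have hxr : ∀ i, ‖x i‖ ≤ r i := fun i => by
      obtain ⟨g'', hg'', e₀, e₁⟩ := (hc i).exists_mul (φ := fun z => (r i : ℂ) / H i z)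
        (fun z hz => (hφd i z hz).continuousAt.continuousWithinAt)
        (fun z hz => (hφd i z ⟨hz.1.le, hz.2.le⟩).differentiableWithinAt)
        ⟨r i / η, fun z hz => (le_div_iff₀ hη).2 (hφn i z hz η (hHη i z hz) hη.le)⟩
      refine hg''.norm_interp_le ?_ (fun y => ?_) fun y => ?_
      · rw [hHt, div_self (Complex.ofReal_ne_zero.2 (hr0 i).ne'), one_smul, hv, hx]
      · rw [e₀, norm_smul]
        refine hφn i _ (by simp) _ ?_ (norm_nonneg _)
        have h1 := ub i y
        have h2 := v0 i (1 - y * Complex.I) (by simp)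
        rw [hHre]
        linarith
      · rw [e₁, norm_smul]
        refine hφn i _ (by simp) _ ?_ (norm_nonneg _)
        have h1 := vb i (-y)
        have h2 := u0 i (1 + y * Complex.I) (by simp)
        rw [hHre]
        have e : (1 : ℂ) - (1 + y * Complex.I) = ((-y : ℝ) : ℂ) * Complex.I := by
          push_cast; ring
        rw [e]
        simp only [neg_neg] at h1
        linarith
    refine (Finset.sum_le_sum fun i _ => hxr i).trans ?_
    simp only [hr, Finset.sum_add_distrib, Finset.sum_const, Finset.card_univ, nsmul_eq_mul]
    linarith
  refine le_of_forall_pos_le_add fun ε hε => ?_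
  have h1 := key (ε / (Fintype.card ι + 1)) (by positivity)
  have h2 : (Fintype.card ι : ℝ) * (ε / (Fintype.card ι + 1)) ≤ ε := by
    rw [mul_div_assoc', div_le_iff₀ (by positivity)]
    nlinarith
  linarith

end InterpolationCouple

/-! ### Rademacher type -/

theorem norm_units_int_smul {E : Type*} [NormedAddCommGroup E] (ε : ℤˣ) (x : E) :
    ‖ε • x‖ = ‖x‖ := by
  rcases Int.units_eq_one_or ε with rfl | rfl <;> simp

theorem units_int_smul_eq {E : Type*} [NormedAddCommGroup E] [NormedSpace ℂ E] (ε : ℤˣ) (x : E) :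
    ε • x = ((ε : ℤ) : ℂ) • x := by
  rcases Int.units_eq_one_or ε with rfl | rfl <;> simp

theorem hasType_one (E : Type*) [NormedAddCommGroup E] : HasType E 1 := by
  refine ⟨1, fun n x => ?_⟩
  have h : ∀ ε : Fin n → ℤˣ, ‖∑ j, ε j • x j‖ ≤ ∑ j, ‖x j‖ := fun ε =>
    norm_sum_le_of_le _ fun j _ => (norm_units_int_smul _ _).le
  have := Finset.sum_le_sum fun ε (_ : ε ∈ (Finset.univ : Finset (Fin n → ℤˣ))) => h ε
  rw [Finset.sum_const, Finset.card_univ, Fintype.card_fun, Fintype.card_units_int,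
    Fintype.card_fin, nsmul_eq_mul] at this
  simp only [Real.rpow_one, div_one, one_mul]
  rw [div_le_iff₀ (by positivity), mul_comm]
  exact_mod_cast this

theorem le_typeIndex {E : Type*} [NormedAddCommGroup E] {p : ℝ} (hp : p ∈ Set.Icc (1 : ℝ) 2)
    (h : HasType E p) : p ≤ typeIndex E :=
  le_csSup ⟨2, fun _ hq => hq.1.2⟩ ⟨hp, h⟩

theorem typeIndex_mem_Icc (E : Type*) [NormedAddCommGroup E] : typeIndex E ∈ Set.Icc (1 : ℝ) 2 :=
  ⟨le_typeIndex ⟨le_rfl, one_le_two⟩ (hasType_one E),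
    csSup_le ⟨1, ⟨le_rfl, one_le_two⟩, hasType_one E⟩ fun _ hq => hq.1.2⟩

theorem HasType.of_embedding {E F : Type*} [NormedAddCommGroup E] [NormedSpace ℂ E]
    [NormedAddCommGroup F] [NormedSpace ℂ F] {p : ℝ} (hp : 0 < p) (h : HasType F p) (T : E →L[ℂ] F)
    {c : ℝ} (hc : ∀ y, ‖y‖ ≤ c * ‖T y‖) : HasType E p := by
  wlog hc0 : 0 ≤ c generalizing c
  · exact this (fun y => (hc y).trans
      (mul_le_mul_of_nonneg_right (le_max_left c 0) (norm_nonneg _))) (le_max_right c 0)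
  obtain ⟨K, hK⟩ := h
  refine ⟨c * (max K 0 * ‖T‖), fun n x => ?_⟩
  have h1 : ∀ ε : Fin n → ℤˣ, ‖∑ j, ε j • x j‖ ≤ c * ‖∑ j, ε j • T (x j)‖ := fun ε => by
    have := hc (∑ j, ε j • x j)
    simpa only [map_sum, units_int_smul_eq, map_smul] using this
  have h2 : (∑ j, ‖T (x j)‖ ^ p) ^ (1 / p) ≤ ‖T‖ * (∑ j, ‖x j‖ ^ p) ^ (1 / p) := by
    have e : ‖T‖ * (∑ j, ‖x j‖ ^ p) ^ (1 / p) = (∑ j, (‖T‖ * ‖x j‖) ^ p) ^ (1 / p) := by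
      simp only [Real.mul_rpow (norm_nonneg T) (norm_nonneg _)]
      rw [← Finset.mul_sum, Real.mul_rpow (by positivity)
        (Finset.sum_nonneg fun j _ => by positivity), ← Real.rpow_mul (norm_nonneg _),
        mul_one_div_cancel hp.ne', Real.rpow_one]
    rw [e]
    refine Real.rpow_le_rpow (Finset.sum_nonneg fun j _ => by positivity)
      (Finset.sum_le_sum fun j _ => Real.rpow_le_rpow (norm_nonneg _) (T.le_opNorm _) hp.le)
      (by positivity)
  have h3 : 0 ≤ (∑ j, ‖T (x j)‖ ^ p) ^ (1 / p) :=
    Real.rpow_nonneg (Finset.sum_nonneg fun j _ => by positivity) _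
  calc (∑ ε : Fin n → ℤˣ, ‖∑ j, ε j • x j‖) / 2 ^ n
      ≤ (∑ ε : Fin n → ℤˣ, c * ‖∑ j, ε j • T (x j)‖) / 2 ^ n :=
        div_le_div_of_nonneg_right (Finset.sum_le_sum fun ε _ => h1 ε) (by positivity)
    _ = c * ((∑ ε : Fin n → ℤˣ, ‖∑ j, ε j • T (x j)‖) / 2 ^ n) := by
        rw [← Finset.mul_sum, mul_div_assoc]
    _ ≤ c * (max K 0 * (∑ j, ‖T (x j)‖ ^ p) ^ (1 / p)) :=
        mul_le_mul_of_nonneg_left ((hK n _).trans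
          (mul_le_mul_of_nonneg_right (le_max_left _ _) h3)) hc0
    _ ≤ c * (max K 0 * (‖T‖ * (∑ j, ‖x j‖ ^ p) ^ (1 / p))) :=
        mul_le_mul_of_nonneg_left (mul_le_mul_of_nonneg_left h2 (le_max_right _ _)) hc0
    _ = c * (max K 0 * ‖T‖) * (∑ j, ‖x j‖ ^ p) ^ (1 / p) := by ring

/-- The type inequality for vectors of norms at most `s * b j ^ (1 / p)`, where `∑ b j ≤ 1`. -/
theorem HasType.sum_norm_le {E : Type*} [NormedAddCommGroup E] {p K : ℝ} (hp : 0 < p)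
    (hK0 : 0 ≤ K) (hK : ∀ (n : ℕ) (x : Fin n → E),
      (∑ ε : Fin n → ℤˣ, ‖∑ j, ε j • x j‖) / 2 ^ n ≤ K * (∑ j, ‖x j‖ ^ p) ^ (1 / p)) {n : ℕ}
    {x : Fin n → E} {b : Fin n → ℝ} (hb : ∀ j, 0 ≤ b j) (hb1 : ∑ j, b j ≤ 1) {s : ℝ} (hs : 0 ≤ s)
    (hx : ∀ j, ‖x j‖ ≤ s * b j ^ (1 / p)) :
    ∑ ε : Fin n → ℤˣ, ‖∑ j, ε j • x j‖ ≤ K * s * 2 ^ n := by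
  rw [← div_le_iff₀ (by positivity)]
  refine (hK n x).trans (mul_le_mul_of_nonneg_left ?_ hK0)
  have h1 : ∑ j, ‖x j‖ ^ p ≤ s ^ p := by
    calc ∑ j, ‖x j‖ ^ p ≤ ∑ j, s ^ p * b j := Finset.sum_le_sum fun j _ => by
          refine (Real.rpow_le_rpow (norm_nonneg _) (hx j) hp.le).trans_eq ?_
          rw [Real.mul_rpow hs (Real.rpow_nonneg (hb j) _), ← Real.rpow_mul (hb j),
            one_div_mul_cancel hp.ne', Real.rpow_one]
      _ ≤ s ^ p := by
          rw [← Finset.mul_sum]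
          exact mul_le_of_le_one_right (Real.rpow_nonneg hs _) hb1
  calc (∑ j, ‖x j‖ ^ p) ^ (1 / p) ≤ (s ^ p) ^ (1 / p) :=
        Real.rpow_le_rpow (Finset.sum_nonneg fun j _ => by positivity) h1 (by positivity)
    _ = s := by rw [← Real.rpow_mul hs, mul_one_div_cancel hp.ne', Real.rpow_one]

namespace InterpolationCouple

variable {X₀ X₁ S : Type*}
  [NormedAddCommGroup X₀] [NormedSpace ℂ X₀] [CompleteSpace X₀]
  [NormedAddCommGroup X₁] [NormedSpace ℂ X₁] [CompleteSpace X₁]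
  [NormedAddCommGroup S] [NormedSpace ℂ S] [CompleteSpace S]
  {C : InterpolationCouple X₀ X₁ S}

/-- A representative whose norms on the two boundary lines are prescribed, up to a factor. -/
theorem exists_isCalderon_of_norm_le_rpow {t : Set.Ioo (0 : ℝ) 1} {x : C.interpSpace t} {M₀ M₁ : ℝ}
    (p₀ : 0 < M₀) (p₁ : 0 < M₁) (hx : ‖x‖ ≤ M₀ ^ (1 - (t : ℝ)) * M₁ ^ (t : ℝ)) :
    ∃ (f : ℂ → S) (g : (ℝ →ᵇ X₀) × (ℝ →ᵇ X₁)), C.IsCalderon f g ∧ f (t : ℝ) = C.incl t x ∧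
      (∀ y, ‖g.1 y‖ ≤ 2 * M₀) ∧ ∀ y, ‖g.2 y‖ ≤ 2 * M₁ := by
  set M := M₀ ^ (1 - (t : ℝ)) * M₁ ^ (t : ℝ) with hM
  have hM0 : 0 < M := by positivity
  obtain ⟨f, g, hf, hfx, b₀, b₁⟩ := exists_isCalderon x hM0
  obtain ⟨f', g', hf', hff, e₀, e₁⟩ := hf.exists_rescale t (div_pos p₁ p₀)
  have hr := div_pos p₁ p₀
  have hinv : ∀ s : ℝ, (M₁ / M₀) ^ s * (M₀ / M₁) ^ s = 1 := fun s => by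
    rw [← Real.mul_rpow hr.le (div_pos p₀ p₁).le, div_mul_div_cancel₀ p₀.ne', div_self p₁.ne',
      Real.one_rpow]
  refine ⟨f', g', hf', hff.trans hfx, fun y => ?_, fun y => ?_⟩
  · have : (M₁ / M₀) ^ (-(t : ℝ)) * M = M₀ := by
      rw [hM, ← (rpow_balance p₀ p₁).1, ← mul_assoc, hinv, one_mul]
    calc ‖g'.1 y‖ = (M₁ / M₀) ^ (-(t : ℝ)) * ‖g.1 y‖ := e₀ y
      _ ≤ (M₁ / M₀) ^ (-(t : ℝ)) * (2 * M) :=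
        mul_le_mul_of_nonneg_left ((b₀ y).trans (by linarith)) (by positivity)
      _ = 2 * M₀ := by linear_combination 2 * this
  · have : (M₁ / M₀) ^ (1 - (t : ℝ)) * M = M₁ := by
      rw [hM, ← (rpow_balance p₀ p₁).2, ← mul_assoc, hinv, one_mul]
    calc ‖g'.2 y‖ = (M₁ / M₀) ^ (1 - (t : ℝ)) * ‖g.2 y‖ := e₁ y
      _ ≤ (M₁ / M₀) ^ (1 - (t : ℝ)) * (2 * M) :=
        mul_le_mul_of_nonneg_left ((b₁ y).trans (by linarith)) (by positivity)
      _ = 2 * M₁ := by linear_combination 2 * this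

/-- Complex interpolation of type. The Calderón functions of the vectors `x j` are chosen with
boundary norms proportional to `‖x j‖ ^ (p / p₀)` and `‖x j‖ ^ (p / p₁)`, so that the type
inequalities of `X₀` and `X₁` apply on the boundary with the same bound, for all choices of signs
together. -/
theorem hasType_interpSpace {p₀ p₁ p : ℝ} (hp₀ : 0 < p₀) (hp₁ : 0 < p₁) (hp : 0 < p)
    (t : Set.Ioo (0 : ℝ) 1) (hpt : 1 / p = (1 - (t : ℝ)) / p₀ + t / p₁) (h₀ : HasType X₀ p₀)
    (h₁ : HasType X₁ p₁) : HasType (C.interpSpace t) p := by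
  obtain ⟨K₀, hK₀⟩ := h₀
  obtain ⟨K₁, hK₁⟩ := h₁
  set K := max (max K₀ K₁) 0 with hK
  have hK0 : 0 ≤ K := le_max_right _ _
  refine ⟨24 * (Real.exp 1 * (K * 2)), fun n x => ?_⟩
  set σ := ∑ j, ‖x j‖ ^ p with hσ
  rcases (Finset.sum_nonneg fun j _ => by positivity : 0 ≤ σ).eq_or_lt with h0 | hσ0
  · have hx : ∀ j, x j = 0 := fun j => by
      have := (Finset.sum_eq_zero_iff_of_nonneg fun j _ => by positivity).1 h0.symm j
        (Finset.mem_univ j)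
      exact norm_eq_zero.1 ((Real.rpow_eq_zero (norm_nonneg _) hp.ne').1 this)
    rw [hσ, ← h0, Real.zero_rpow (by positivity)]
    simp [hx]
  set s := σ ^ (1 / p) with hs
  have hs0 : 0 < s := Real.rpow_pos_of_pos hσ0 _
  set b : Fin n → ℝ := fun j => ‖x j‖ ^ p / σ with hb
  have hb0 : ∀ j, 0 ≤ b j := fun j => by positivity
  have hb1 : ∑ j, b j ≤ 1 := by
    rw [hb, ← Finset.sum_div, ← hσ, div_self hσ0.ne']
  have hF : ∀ j, ∃ (f : ℂ → S) (g : (ℝ →ᵇ X₀) × (ℝ →ᵇ X₁)), C.IsCalderon f g ∧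
      f (t : ℝ) = C.incl t (x j) ∧ (∀ y, ‖g.1 y‖ ≤ 2 * s * b j ^ (1 / p₀)) ∧
      ∀ y, ‖g.2 y‖ ≤ 2 * s * b j ^ (1 / p₁) := fun j => by
    by_cases hxj : x j = 0
    · refine ⟨0, 0, IsCalderon.zero, by simp [hxj], fun y => ?_, fun y => ?_⟩
      · have : 0 ≤ 2 * s * b j ^ (1 / p₀) := by positivity
        simpa using this
      · have : 0 ≤ 2 * s * b j ^ (1 / p₁) := by positivity
        simpa using this
    · have hbj : 0 < b j := div_pos (Real.rpow_pos_of_pos (norm_pos_iff.2 hxj) _) hσ0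
      obtain ⟨f, g, hf, hfx, h1, h2⟩ := exists_isCalderon_of_norm_le_rpow (x := x j)
        (M₀ := s * b j ^ (1 / p₀)) (M₁ := s * b j ^ (1 / p₁)) (by positivity) (by positivity) (by
          rw [mul_rpow_mul_mul_rpow hs0 (by positivity) (by positivity), ← Real.rpow_mul hbj.le,
            ← Real.rpow_mul hbj.le, ← Real.rpow_add hbj,
            show 1 / p₀ * (1 - (t : ℝ)) + 1 / p₁ * t = 1 / p by rw [hpt]; ring, hs,
            ← Real.mul_rpow hσ0.le hbj.le, hb, mul_div_cancel₀ _ hσ0.ne',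
            ← Real.rpow_mul (norm_nonneg _), mul_one_div_cancel hp.ne', Real.rpow_one])
      exact ⟨f, g, hf, hfx, fun y => (h1 y).trans_eq (by ring), fun y => (h2 y).trans_eq (by ring)⟩
  choose f g hf hfx h1 h2 using hF
  have hsum := IsCalderon.sum_norm_interp_le (C := C) (t := t)
    (f := fun ε : Fin n → ℤˣ => ∑ j, ((ε j : ℤ) : ℂ) • f j)
    (g := fun ε : Fin n → ℤˣ => ∑ j, ((ε j : ℤ) : ℂ) • g j)
    (x := fun ε : Fin n → ℤˣ => ∑ j, ε j • x j) (A := K * (2 * s) * 2 ^ n)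
    (fun ε => IsCalderon.sum _ fun j _ => (hf j).smul _) (fun ε => by
      simp [map_sum, units_int_smul_eq, hfx])
    (fun y => by
      have := HasType.sum_norm_le hp₀ hK0 (fun n x => (hK₀ n x).trans
        (mul_le_mul_of_nonneg_right ((le_max_left _ _).trans (le_max_left _ _))
          (Real.rpow_nonneg (Finset.sum_nonneg fun j _ => by positivity) _))) hb0 hb1
        (by positivity) (fun j => h1 j y)
      simpa [Prod.fst_sum, BoundedContinuousFunction.sum_apply, units_int_smul_eq] using this)
    (fun y => by
      have := HasType.sum_norm_le hp₁ hK0 (fun n x => (hK₁ n x).trans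
        (mul_le_mul_of_nonneg_right ((le_max_right _ _).trans (le_max_left _ _))
          (Real.rpow_nonneg (Finset.sum_nonneg fun j _ => by positivity) _))) hb0 hb1
        (by positivity) (fun j => h2 j y)
      simpa [Prod.snd_sum, BoundedContinuousFunction.sum_apply, units_int_smul_eq] using this)
  rw [div_le_iff₀ (by positivity)]
  refine hsum.trans_eq ?_
  ring

theorem totallyIncomparable_of_typeIndex (θ : Set.Ioo (0 : ℝ) 1) (h₀ : HasType X₀ (typeIndex X₀))
    (h₁ : HasType X₁ (typeIndex X₁)) (hlt : typeIndex X₀ < typeIndex X₁)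
    (hθ : ∀ W : Submodule ℂ (C.interpSpace θ), IsClosed (W : Set (C.interpSpace θ)) →
      ¬ FiniteDimensional ℂ W →
      1 / typeIndex W = (1 - (θ : ℝ)) / typeIndex X₀ + (θ : ℝ) / typeIndex X₁)
    {t : Set.Ioo (0 : ℝ) 1} (ht : θ < t) :
    TotallyIncomparable (C.interpSpace θ) (C.interpSpace t) := by
  refine TotallyIncomparable.of_forall_embedding fun Y hYc hY T c hc => ?_
  have hY' := hθ Y hYc hY
  set p₀ := typeIndex X₀ with hp₀
  set p₁ := typeIndex X₁ with hp₁
  obtain ⟨l₀, u₀⟩ := typeIndex_mem_Icc X₀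
  obtain ⟨l₁, u₁⟩ := typeIndex_mem_Icc X₁
  rw [← hp₀] at l₀ u₀
  rw [← hp₁] at l₁ u₁
  have q₀ : 0 < p₀ := by linarith
  have q₁ : 0 < p₁ := by linarith
  have hinv : 1 / p₁ < 1 / p₀ := one_div_lt_one_div_of_lt q₀ hlt
  have ht0 := t.2.1
  have ht1 := t.2.2
  have htθ : (θ : ℝ) < t := ht
  -- the type of `X_t`
  set q := (1 - (t : ℝ)) * (1 / p₀) + t * (1 / p₁) with hq
  have hq1 : q ≤ 1 := by
    have : 1 / p₀ ≤ 1 := by rw [div_le_one q₀]; exact l₀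
    nlinarith
  have hq2 : 1 / 2 ≤ q := by
    have : 1 / 2 ≤ 1 / p₁ := one_div_le_one_div_of_le q₁ u₁
    nlinarith
  have hq0 : 0 < q := by linarith
  have htype : HasType (C.interpSpace t) (1 / q) :=
    hasType_interpSpace q₀ q₁ (by positivity) t (by rw [one_div_one_div, hq]; ring) h₀ h₁
  have hle : 1 / q ≤ typeIndex Y := by
    refine le_typeIndex ⟨?_, ?_⟩ (htype.of_embedding (by positivity) T hc)
    · rw [le_div_iff₀ hq0]; linarith
    · rw [div_le_iff₀ hq0]; linarith
  have h1 : 1 / typeIndex Y ≤ q := by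
    have := one_div_le_one_div_of_le (by positivity) hle
    rwa [one_div_one_div] at this
  rw [hY', hq, div_eq_mul_one_div, div_eq_mul_one_div (θ : ℝ)] at h1
  nlinarith

end InterpolationCouple

end

theorem mainTheorem5 {X₀ X₁ S : Type*}
    [NormedAddCommGroup X₀] [NormedSpace ℂ X₀] [CompleteSpace X₀]
    [NormedAddCommGroup X₁] [NormedSpace ℂ X₁] [CompleteSpace X₁]
    [NormedAddCommGroup S] [NormedSpace ℂ S] [CompleteSpace S]
    (C : InterpolationCouple X₀ X₁ S) (θ : Set.Ioo (0 : ℝ) 1) :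
    (∀ (e₀ : UnconditionalSchauderBasis ℕ ℂ X₀) (e₁ : UnconditionalSchauderBasis ℕ ℂ X₁)
        (he : C.IsCommonBasis e₀ e₁),
      limsup (fun n : ℕ => ((piM e₁ n / piM e₀ n : ℝ) : EReal)) atTop = ⊤ →
      (∀ w : ℕ → C.interpSpace θ, DisjointlySupported (he.vec θ) w →
        piM w =Θ[atTop] fun n => piM e₀ n ^ (1 - (θ : ℝ)) * piM e₁ n ^ (θ : ℝ)) →
      ∀ t : Set.Ioo (0 : ℝ) 1, t < θ →
        TotallyIncomparable (C.interpSpace θ) (C.interpSpace t)) ∧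
    (∀ (e₀ : SchauderBasis ℂ X₀) (e₁ : SchauderBasis ℂ X₁) (he : C.IsCommonBasis e₀ e₁),
      limsup (fun n : ℕ => ((piA e₁ ⊤ n / piA e₀ ⊤ n : ℝ) : EReal)) atTop = ⊤ →
      (∀ w : ℕ → C.interpSpace θ, IsBlockSequence (he.vec θ) w →
        piA (he.vec θ) (closedSpan w) =Θ[atTop]
          fun n => piA e₀ ⊤ n ^ (1 - (θ : ℝ)) * piA e₁ ⊤ n ^ (θ : ℝ)) →
      ∀ t : Set.Ioo (0 : ℝ) 1, t < θ →
        TotallyIncomparable (C.interpSpace θ) (C.interpSpace t)) ∧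
    (HasType X₀ (typeIndex X₀) → HasType X₁ (typeIndex X₁) →
      typeIndex X₀ < typeIndex X₁ →
      (∀ W : Submodule ℂ (C.interpSpace θ), IsClosed (W : Set (C.interpSpace θ)) →
        ¬ FiniteDimensional ℂ W →
        1 / typeIndex W = (1 - (θ : ℝ)) / typeIndex X₀ + (θ : ℝ) / typeIndex X₁) →
      ∀ t : Set.Ioo (0 : ℝ) 1, θ < t →
        TotallyIncomparable (C.interpSpace θ) (C.interpSpace t)) := by
  exact ⟨fun e₀ e₁ he hlim hθ t ht => InterpolationCouple.totallyIncomparable_of_piM θ e₀ e₁ he hlim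
      (fun w hw => (hθ w hw).2) ht,
    fun e₀ e₁ he hlim hθ t ht => InterpolationCouple.totallyIncomparable_of_piA θ e₀ e₁ he hlim
      (fun w hw => (hθ w hw).2) ht,
    fun h₀ h₁ hlt hθ t ht => InterpolationCouple.totallyIncomparable_of_typeIndex θ h₀ h₁ hlt hθ ht⟩
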